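/- Setting. Let $\mathcal S$ be a set of prompts with a discrete distribution $\rho$, $\mathcal A$ a finite response set, $\pi_{\rm ref}$ a reference policy with $\pi_{\rm ref}(a|s)>0$, $\beta>0$, $R>0$, and $r^*:\mathcal S\times\mathcal A\to[0,R]$ an unknown reward. For a policy $\pi$ let $\mathrm{KL}(\pi\|\pi_{\rm ref})=\mathbb E_{s\sim\rho,a\sim\pi}[\log\frac{\pi(a|s)}{\pi_{\rm ref}(a|s)}]$ and $J_\beta(\pi)=\mathbb E_{\rho,\pi}[r^*]-\beta\,\mathrm{KL}(\pi\|\pi_{\rm ref})$, and let $\pi^*\propto\pi_{\rm ref}e^{r^*/\beta}$ be the optimal policy. The policy class $\Pi$ is finite, contains $\pi^*$, and $|\log\frac{\pi(a|s)}{\pi_{\rm ref}(a|s)}|\le R/\beta$ for all $\pi\in\Pi$, $s$, $a$. Playing $\pi$ yields a sample $s\sim\rho$, $a\sim\pi(\cdot|s)$, $\tilde a\sim\pi_{\rm ref}(\cdot|s)$ and a Bradley–Terry label, $\Pr[y=1]=\sigma(r^*(s,a)-r^*(s,\tilde a))$. The regret of policies $\pi^1,\dots,\pi^t$ is $\sum_{i\le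 t}(J_\beta(\pi^*)-J_\beta(\pi^i))$. Online oracle. Let $\delta\in(0,1)$, $C_{\rm OL}>0$, $c_0\ge1$, $\mathcal C(\Pi)\ge0$. An online algorithm (possibly randomized, choosing each next policy in $\mathrm{conv}(\Pi)$ from its own data) is no-regret with horizon $\tilde T$ if, run on its own, with probability at least $1-\delta$ its regret after $t$ iterations is at most $C_{\rm OL}Re^{2R}\sqrt{\mathcal C(\Pi)\,t\,\log^{c_0}(|\Pi|\tilde T/\delta)}$ for all $t\le\tilde T$. Algorithm (TPO). $T=KN$ iterations are split into $K$ blocks of length $N$; $\alpha\in(0,1)$, $\alpha N\ge1$. In iterations $n\le\alpha N$ of each block the policy is chosen by a no-regret online algorithm with horizon $\tilde T=K\lfloor\alpha N\rfloor$ from the data it collected itself; in the other iterations it is chosen by transfer policy selection (TPS) from the whole dataset $D$ collected so far. TPS returns the policy with the highest estimated value among the $W$ source policies (optimal for the given source rewards; values estimated optimistically from a maximum-likelihood reward) and the self-transfer policy $\pi_{\rm Dstl}$ (value estimated pessimistically), where $\pi_{\rm Dstl}$ solves $$\max_{\pi\in\mathrm{conv}(\Pi)}\ \min_{r\in\mathcal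 R^\Pi}\ L_D(r)+\eta\big(\mathbb E_{\rho,\pi}[r]-\mathbb E_{\rho,\pi_{\rm ref}}[r]-\beta\,\mathrm{KL}(\pi\|\pi_{\rm ref})\big),\qquad \eta=c\,(1+e^R)^{-2}\sqrt{\tfrac1{|D|}\log\tfrac{|\Pi|T}{\delta}} .$$ Here $L_D$ is the average negative log-likelihood of the labels, $c>0$ is a constant, and $\mathcal R^\Pi$ consists of the rewards $\mathrm{Clip}_{[0,R]}[\beta\log\frac{\pi(a|s)}{\pi_{\rm ref}(a|s)}-\min_{a'}\beta\log\frac{\pi(a'|s)}{\pi_{\rm ref}(a'|s)}]$, $\pi\in\Pi$. Corollary. Let there be no source tasks ($W=0$). Then the policies TPS can return on a dataset are exactly the self-transfer policies $\pi_{\rm Dstl}$ of that dataset. Moreover there are $C>0$ and $p\in\mathbb N$ depending only on $c,C_{\rm OL},c_0$ such that, with $\ell=\log(|\Pi|T/\delta)$ and $\kappa(x)=\frac{(x-1)^2}{x-1-\log x}$, with probability at least $1-2\delta$ the following holds for all $t$ with $N\le t\le T$ and $$t\ \ge\ C\,\frac{\kappa(e^{2R/\beta})^2}{\alpha^2\beta^2}\,(1+R)^2e^{4R}\,(1+\mathcal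 C(\Pi))\,\ell^{p}:$$ (i) the regret of the transfer (non-online) iterations up to $t$ is at most $C e^{2R}\sqrt t\,\ell^{p}$, with no dependence on $\mathcal C(\Pi)$, $|\mathcal S|$ or $|\mathcal A|$; (ii) the total regret up to $t$ is at most $C e^{2R}\big(1+R\sqrt{\alpha\,\mathcal C(\Pi)}\big)\sqrt t\,\ell^{p}$; (iii) if $\alpha\,\mathcal C(\Pi)\le\max(1,\ell^2)$ (in particular if $\alpha\,\mathcal C(\Pi)\le 1$, and, for every fixed $\alpha$ and $\mathcal C(\Pi)$, for all large $T$), the total regret up to $t$ is at most $C(1+R)e^{2R}\sqrt t\,\ell^{p}$, with no dependence on $\mathcal C(\Pi)$, $|\mathcal S|$ or $|\mathcal A|$. -/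

import Mathlib

noncomputable section

open scoped Classical

namespace RLHF

/-- A policy: for every prompt `s`, a probability vector over the finite response set `A`. -/
abbrev Policy (S A : Type*) [Fintype A] := S → stdSimplex ℝ A

/-- One interaction `(s, a, ã, y, π)`. The label `y = true` means that `a` is preferred to `ã`. -/
structure Step (S A : Type*) [Fintype A] where
  state : S
  act : A
  act' : A
  label : Bool
  policy : Policy S A

/-- A dataset, in the order of collection (oldest sample first). -/
abbrev Dataset (S A : Type*) [Fintype A] := List (Step S A)

/-- The unknown preference-learning problem: prompt distribution `ρ`, reference policy `πref` with
full support, regularization `β > 0`, and a ground-truth reward `rstar` with values in `[0, R]`. -/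
structure Problem (S A : Type*) [Fintype A] where
  ρ : PMF S
  πref : Policy S A
  rstar : S → A → ℝ
  β : ℝ
  R : ℝ
  β_pos : 0 < β
  R_pos : 0 < R
  πref_pos : ∀ s a, 0 < πref s a
  rstar_mem : ∀ s a, rstar s a ∈ Set.Icc 0 R

section Distributions

variable {S A : Type*} [Fintype A]

/-- A probability vector as a `PMF`, for sampling. -/
def toPMF (p : stdSimplex ℝ A) : PMF A :=
  PMF.ofFintype (fun a => ENNReal.ofReal (p a)) (by
    have h : ∑ a, p a = 1 := p.2.2
    have h0 : ∀ a ∈ Finset.univ, 0 ≤ p a := fun a _ => p.2.1 a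
    rw [← ENNReal.ofReal_sum_of_nonneg h0, h, ENNReal.ofReal_one])

/-- The Bradley-Terry label with reward difference `x`: `true` with probability `σ(x)`. -/
def labelPMF (x : ℝ) : PMF Bool :=
  PMF.ofFintype
    (fun b => ENNReal.ofReal (if b then Real.sigmoid x else 1 - Real.sigmoid x)) (by
      rw [← ENNReal.ofReal_sum_of_nonneg]
      · simp
      · intro b _
        cases b
        · simpa using Real.sigmoid_le_one x
        · simpa using Real.sigmoid_nonneg x)

/-- The convex hull `conv(Π)`: pointwise convex combinations of policies of `Pi`. -/
def conv (Pi : Finset (Policy S A)) : Set (Policy S A) :=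
  {π | (fun s a => π s a) ∈
    convexHull ℝ ((fun (π' : Policy S A) (s : S) (a : A) => π' s a) '' (Pi : Set (Policy S A)))}

end Distributions

namespace Problem

variable {S A : Type*} [Fintype A] (P : Problem S A)

/-- `𝔼_{s ∼ ρ, a ∼ π}[f(s, a)]`. -/
def expect (π : Policy S A) (f : S → A → ℝ) : ℝ :=
  ∑' s, (P.ρ s).toReal * ∑ a, π s a * f s a

/-- `KL(π ‖ πref) = 𝔼_{s ∼ ρ, a ∼ π}[log (π(a|s) / πref(a|s))]`. -/
def kl (π : Policy S A) : ℝ :=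
  P.expect π fun s a => Real.log (π s a / P.πref s a)

/-- The regularized policy value `J_β(π) = 𝔼_{ρ,π}[r*] - β KL(π ‖ πref)`. -/
def J (π : Policy S A) : ℝ := P.expect π P.rstar - P.β * P.kl π

/-- The optimal regularized policy for a reward `r`:
`π*_r(a|s) = πref(a|s) exp(r(s,a)/β) / ∑_b πref(b|s) exp(r(s,b)/β)`. -/
def optPolicy (r : S → A → ℝ) : Policy S A := fun s =>
  ⟨fun a => P.πref s a * Real.exp (r s a / P.β) /
      ∑ b, P.πref s b * Real.exp (r s b / P.β), by
    have hnn : ∀ b, 0 ≤ P.πref s b * Real.exp (r s b / P.β) := fun b =>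
      mul_nonneg (P.πref_pos s b).le (Real.exp_pos _).le
    refine ⟨fun a => div_nonneg (hnn a) (Finset.sum_nonneg fun b _ => hnn b), ?_⟩
    rw [← Finset.sum_div]
    refine div_self (ne_of_gt ?_)
    have hne : (Finset.univ : Finset A).Nonempty := by
      by_contra h
      have h1 : ∑ a, P.πref s a = 1 := (P.πref s).2.2
      rw [Finset.not_nonempty_iff_eq_empty.mp h] at h1
      simp at h1
    exact Finset.sum_pos (fun b _ => mul_pos (P.πref_pos s b) (Real.exp_pos _)) hne⟩

/-- The instantaneous regret `J_β(π*_{r*}) - J_β(π)`. -/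
def gap (π : Policy S A) : ℝ := P.J (P.optPolicy P.rstar) - P.J π

/-- The policy class assumption: (I) realizability `π*_{r*} ∈ Π`; (II) every policy of the class
has log-ratio to the reference policy bounded by `R / β`. -/
structure PolicyClass (Pi : Finset (Policy S A)) : Prop where
  realizable : P.optPolicy P.rstar ∈ Pi
  bounded_ratio : ∀ π ∈ Pi, ∀ s a,
    0 < π s a ∧ |Real.log (π s a / P.πref s a)| ≤ P.R / P.β

/-! ### Sequential data collection -/

/-- Collect one sample `s ∼ ρ, a ∼ π(·|s), ã ∼ πref(·|s), y ∼ ℙ_{r*}(·|s, a, ã)`. -/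
def sample (π : Policy S A) : PMF (Step S A) :=
  P.ρ.bind fun s => (toPMF (π s)).bind fun a => (toPMF (P.πref s)).bind fun a' =>
    (labelPMF (P.rstar s a - P.rstar s a')).map fun y => ⟨s, a, a', y, π⟩

/-- The law of the dataset after `n` iterations of a (possibly randomized) algorithm `next`, which
chooses the next policy from the interaction history. -/
def runLaw (next : Dataset S A → PMF (Policy S A)) : ℕ → PMF (Dataset S A)
  | 0 => PMF.pure []
  | n + 1 => (runLaw next n).bind fun D => (next D).bind fun π =>
      (P.sample π).map fun x => D ++ [x]

/-- The cumulative regret of the policies that collected a list of samples. -/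
def regret (D : Dataset S A) : ℝ := (D.map fun x => P.gap x.policy).sum

/-- No-regret online algorithm with horizon `T`, confidence `δ`, constants `COL`, `c0` and
complexity measure `Cpx = 𝒞(Π)` : run on its own for `T` iterations, it plays policies of `conv(Π)`,
and with probability at least `1 - δ`, for all `t ≤ T`, its regret after `t` iterations is at most
`COL R e^{2R} √(𝒞(Π) t log^{c0}(|Π| T / δ))`. -/
structure NoRegretOnline (Pi : Finset (Policy S A)) (COL c0 Cpx δ : ℝ) (T : ℕ)
    (alg : Dataset S A → PMF (Policy S A)) : Prop where
  mem_conv : ∀ D, ∀ π ∈ (alg D).support, π ∈ conv Pi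
  regret_le : ENNReal.ofReal (1 - δ) ≤ (P.runLaw alg T).toOuterMeasure
    {D | ∀ t : ℕ, 1 ≤ t → t ≤ T → P.regret (D.take t) ≤
      COL * P.R * Real.exp (2 * P.R) *
        √(Cpx * t * Real.log (Pi.card * T / δ) ^ c0)}

/-! ### Transfer policy selection -/

/-- The reward function converted from a policy. -/
def rewardOf (π : Policy S A) : S → A → ℝ := fun s a =>
  max 0 (min P.R (P.β * Real.log (π s a / P.πref s a) -
    ⨅ a', P.β * Real.log (π s a' / P.πref s a')))

/-- The reward class `ℛ^Π`. -/
def rewardClass (Pi : Finset (Policy S A)) : Set (S → A → ℝ) := {r | ∃ π ∈ Pi, r = P.rewardOf π}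

/-- The average negative log-likelihood loss `L_D(r)`. -/
def nll (D : Dataset S A) (r : S → A → ℝ) : ℝ :=
  1 / D.length * (D.map fun x =>
    if x.label then -Real.log (Real.sigmoid (r x.state x.act - r x.state x.act'))
    else -Real.log (Real.sigmoid (r x.state x.act' - r x.state x.act))).sum

/-- `r` is a maximum likelihood estimate in `ℛ^Π`. -/
def IsMLE (Pi : Finset (Policy S A)) (D : Dataset S A) (r : S → A → ℝ) : Prop :=
  r ∈ P.rewardClass Pi ∧ ∀ r' ∈ P.rewardClass Pi, nll D r ≤ nll D r'

/-- The offline objective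
`L_D(r) + η (𝔼_{s∼ρ,a∼π,ã∼πref}[r(s,a) - r(s,ã)] - β KL(π ‖ πref))`. -/
def rpoObj (D : Dataset S A) (η : ℝ) (π : Policy S A) (r : S → A → ℝ) : ℝ :=
  nll D r + η * (P.expect π r - P.expect P.πref r - P.β * P.kl π)

/-- `(π, r)` solves `max_{π ∈ conv(Π)} min_{r ∈ ℛ^Π}` of the offline objective: `r` attains the
inner minimum at `π`, and for every `π'` in `conv(Π)` the inner minimum at `π'` (over a finite
class) is at most the inner minimum at `π`. -/
def IsRPO (Pi : Finset (Policy S A)) (D : Dataset S A) (η : ℝ) (π : Policy S A)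
    (r : S → A → ℝ) : Prop :=
  π ∈ conv Pi ∧ r ∈ P.rewardClass Pi ∧
  (∀ r' ∈ P.rewardClass Pi, P.rpoObj D η π r ≤ P.rpoObj D η π r') ∧
  ∀ π' ∈ conv Pi, ∃ r' ∈ P.rewardClass Pi, P.rpoObj D η π' r' ≤ P.rpoObj D η π r

/-- `η = c (1 + e^R)^{-2} √(|D|⁻¹ log(|Π| T / δ))`. -/
def eta (Pi : Finset (Policy S A)) (c δ : ℝ) (T : ℕ) (D : Dataset S A) : ℝ :=
  c * ((1 + Real.exp P.R) ^ 2)⁻¹ * √(1 / D.length * Real.log (Pi.card * T / δ))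

/-- `N(w; D)`: the number of samples collected with the policy `π`. -/
def countPolicy (D : Dataset S A) (π : Policy S A) : ℕ := D.countP fun x => decide (x.policy = π)

/-- Optimistic value estimate of the source policy `π*_{r^w}` (infinite if that policy has not been
played yet). -/
def vSource {W : ℕ} (src : Fin W → S → A → ℝ) (Pi : Finset (Policy S A)) (δ : ℝ) (T : ℕ)
    (D : Dataset S A) (rMLE : S → A → ℝ) (w : Fin W) : EReal :=
  if countPolicy D (P.optPolicy (src w)) = 0 then ⊤ else
    ((P.expect (P.optPolicy (src w)) rMLE - P.expect P.πref rMLE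
      - P.β * P.kl (P.optPolicy (src w))
      + 16 * Real.exp (2 * P.R) *
        √(1 / countPolicy D (P.optPolicy (src w)) * Real.log (Pi.card * W * T / δ)) : ℝ) : EReal)

/-- Pessimistic value estimate of the distilled policy. -/
def vDstl (Pi : Finset (Policy S A)) (c δ : ℝ) (T : ℕ) (D : Dataset S A)
    (rMLE : S → A → ℝ) (π : Policy S A) (r : S → A → ℝ) : EReal :=
  ((P.expect π r - P.expect P.πref r - P.β * P.kl π
    + 1 / P.eta Pi c δ T D * nll D r - 1 / P.eta Pi c δ T D * nll D rMLE
    - 2 * c * Real.exp (2 * P.R) * √(1 / D.length * Real.log (Pi.card * T / δ)) : ℝ) : EReal)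

/-- `π` is a possible output of transfer policy selection (TPS) on the dataset `D` with source
rewards `src`: a policy with the highest estimated value among the source policies and the
distilled ("self-transfer") policy, which is the candidate `none`. -/
def IsTPS {W : ℕ} (src : Fin W → S → A → ℝ) (Pi : Finset (Policy S A)) (c δ : ℝ) (T : ℕ)
    (D : Dataset S A) (π : Policy S A) : Prop :=
  ∃ (rMLE : S → A → ℝ) (πD : Policy S A) (rD : S → A → ℝ) (i : Option (Fin W)),
    P.IsMLE Pi D rMLE ∧ P.IsRPO Pi D (P.eta Pi c δ T D) πD rD ∧
    (∀ j : Option (Fin W),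
      j.elim (P.vDstl Pi c δ T D rMLE πD rD) (P.vSource src Pi δ T D rMLE) ≤
        i.elim (P.vDstl Pi c δ T D rMLE πD rD) (P.vSource src Pi δ T D rMLE)) ∧
    π = i.elim πD fun w => P.optPolicy (src w)

end Problem

/-! ### Transfer policy optimization -/

section TPO

variable {S A : Type*} [Fintype A]

/-- The iteration following `i` completed iterations, at inner index `n = (i mod N) + 1` of its
block of length `N`, is an online-learning iteration iff `n ≤ α N`. -/
def IsOnline (N : ℕ) (α : ℝ) (i : ℕ) : Prop := ((i % N : ℕ) : ℝ) + 1 ≤ α * N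

/-- The samples of `D` collected by the online algorithm. -/
def onlineData (N : ℕ) (α : ℝ) (D : Dataset S A) : Dataset S A :=
  (D.zipIdx.filter fun x => decide (IsOnline N α x.2)).map Prod.fst

/-- The samples of `D` collected by transfer policies. -/
def transferData (N : ℕ) (α : ℝ) (D : Dataset S A) : Dataset S A :=
  (D.zipIdx.filter fun x => decide (¬ IsOnline N α x.2)).map Prod.fst

/-- TPO: in online iterations, call the online algorithm on the data it has collected itself; in the
other iterations, play the transfer policy selected from all the data. -/
def tpo (N : ℕ) (α : ℝ) (alg : Dataset S A → PMF (Policy S A)) (tps : Dataset S A → Policy S A)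
    (D : Dataset S A) : PMF (Policy S A) :=
  if IsOnline N α D.length then alg (onlineData N α D) else PMF.pure (tps D)

end TPO

/-- `κ(x) = (x - 1)² / (x - 1 - log x)`. -/
def kappa (x : ℝ) : ℝ := (x - 1) ^ 2 / (x - 1 - Real.log x)

end RLHF

end

noncomputable section

open scoped Classical

namespace RLHF

/-! ### Scalar inequalities -/

/-! Write `x = π*/π`. Up to a function of the prompt, `r*` is `β log(π*/πref)`, so the gap of `π` is
`β KL(π‖π*)`, that is `β` times the `π`-mean of `x - 1 - log x` (`gap_eq`). Two consequences carry
the proof. The gap is convex in `π`, so a uniform mixture of policies has at most their average gap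
(`exists_average`). And `(x-1)² ≤ κ(M)(x - 1 - log x)` on `(0, M]` with `M = e^{2R/β}`, so the
second moment of `π*/π` under `π` is at most `1 + (κ/β) gap` (`expect_sq_ratio_le`): data from
near-optimal policies cover `π*` almost perfectly, whatever the sizes of the prompt and response
sets.

The statistical input is a likelihood-ratio supermartingale. With probability at least `1 - δ`,
simultaneously for all prefixes of the data and all rewards of the class, the log-likelihood
advantage of a reward over the true one is at most `2l` minus a multiple of its accumulated squared
relative error (`toOuterMeasure_stepWeight_le`, `likelihoodBound_of_stepWeight_le`). The max-min
policy loses to a competitor only the relative reward error under that competitor plus a likelihood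
difference (`IsRPO.gap_le`). Weighted AM-GM turns the first into squared error, which the second
cancels.

Two competitors are used. Against the mixture of the online policies (`IsRPO.gap_le_average`) each
transfer gap is at most `X/√i`, where `X` contains `𝒞(Π)` and `1/α`. Against `π*` itself
(`IsRPO.gap_le_coverage`) it is of order `√(l/i)` times `2 + (κ/β)` (average regret so far).
Inserting the first bound into the second makes the complexity-dependent part of order `1/i`; it
sums to a logarithm, and the lower bound on `t` absorbs its coefficient into `√t`
(`transfer_regret_le`).

The online iterations inside the algorithm have the law of a stand-alone run
(`map_onlineData_runLaw`), so the oracle's guarantee applies to them. They are at most `2αt` in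
number once `t ≥ N`, whence the term `R √(α 𝒞(Π))` in the total regret. -/

lemma sub_one_sub_log_pos {M : ℝ} (hM : 1 < M) : 0 < M - 1 - Real.log M := by
  have := Real.log_lt_sub_one_of_pos (by linarith) hM.ne'
  linarith

lemma sub_one_sub_log_nonneg {x : ℝ} (hx : 0 < x) : 0 ≤ x - 1 - Real.log x := by
  have := Real.log_le_sub_one_of_pos hx
  linarith

/-- Comes from `log(1+u) ≥ 2u/(u+2)`. It places the second critical point in
`sq_sub_one_le_kappa_mul` at or above 1. -/
lemma two_mul_sub_one_sub_log_le {M : ℝ} (hM : 1 ≤ M) :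
    2 * (M - 1 - Real.log M) ≤ (M - 1) ^ 2 := by
  have h := Real.le_log_one_add_of_nonneg (x := M - 1) (by linarith)
  rw [show 1 + (M - 1) = M by ring, show M - 1 + 2 = M + 1 by ring] at h
  have h2 : (M - 1) - (M - 1) ^ 2 / 2 ≤ 2 * (M - 1) / (M + 1) := by
    rw [le_div_iff₀ (by linarith)]
    nlinarith [pow_nonneg (sub_nonneg.mpr hM) 3]
  linarith

/-- The difference `F`, with denominators cleared, vanishes at 1 and at `M`. Its derivative changes
sign only at 1 and at `(M-1)²/(2v) ≥ 1`. So `F` decreases to 0 at 1, then increases, then decreases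
towards 0 at `M`, and it is nonnegative on all of `(0, M]`. -/
lemma sq_sub_one_le_kappa_mul {M x : ℝ} (hM : 1 < M) (hx : 0 < x) (hxM : x ≤ M) :
    (x - 1) ^ 2 ≤ kappa M * (x - 1 - Real.log x) := by
  set v := M - 1 - Real.log M with hv
  have hv0 : 0 < v := sub_one_sub_log_pos hM
  have hv2 : 2 * v ≤ (M - 1) ^ 2 := two_mul_sub_one_sub_log_le hM.le
  set F : ℝ → ℝ := fun x => (M - 1) ^ 2 * (x - 1 - Real.log x) - v * (x - 1) ^ 2 with hF
  have hd : ∀ y : ℝ, 0 < y → HasDerivAt F ((y - 1) * ((M - 1) ^ 2 - 2 * v * y) / y) y := by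
    intro y hy
    have h1 : HasDerivAt F ((M - 1) ^ 2 * (1 - y⁻¹) - v * (2 * (y - 1))) y := by
      have ha := (((hasDerivAt_id y).sub_const 1).sub (Real.hasDerivAt_log hy.ne')).const_mul
        ((M - 1) ^ 2)
      have hb := (((hasDerivAt_id y).sub_const 1).pow 2).const_mul v
      refine (ha.sub hb).congr_deriv ?_
      simp
    refine h1.congr_deriv ?_
    field_simp
  have hc : ContinuousOn F (Set.Ioi 0) := fun y hy =>
    (hd y hy).continuousAt.continuousWithinAt
  have hF1 : F 1 = 0 := by simp [hF]
  have hFM : F M = 0 := by simp only [hF]; rw [← hv]; ring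
  have key : 0 ≤ F x := by
    rcases le_total x 1 with h | h
    · rw [← hF1]
      refine antitoneOn_of_deriv_nonpos (convex_Icc x 1)
        (hc.mono fun y hy => lt_of_lt_of_le hx hy.1)
        (fun y hy => ((hd y ?_).differentiableAt).differentiableWithinAt) (fun y hy => ?_)
        (Set.left_mem_Icc.mpr h) (Set.right_mem_Icc.mpr h) h
      · rw [interior_Icc] at hy; exact hx.trans hy.1
      · rw [interior_Icc] at hy
        have hy0 : 0 < y := hx.trans hy.1
        rw [(hd y hy0).deriv]
        refine div_nonpos_of_nonpos_of_nonneg (mul_nonpos_of_nonpos_of_nonneg ?_ ?_) hy0.le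
        · linarith [hy.2]
        · nlinarith [hy.2]
    · rcases le_total (2 * v * x) ((M - 1) ^ 2) with h' | h'
      · rw [← hF1]
        refine monotoneOn_of_deriv_nonneg (convex_Icc 1 x)
          (hc.mono fun y hy => lt_of_lt_of_le one_pos hy.1)
          (fun y hy => ((hd y ?_).differentiableAt).differentiableWithinAt) (fun y hy => ?_)
          (Set.left_mem_Icc.mpr h) (Set.right_mem_Icc.mpr h) h
        · rw [interior_Icc] at hy; exact one_pos.trans hy.1
        · rw [interior_Icc] at hy
          have hy0 : 0 < y := one_pos.trans hy.1
          rw [(hd y hy0).deriv]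
          refine div_nonneg (mul_nonneg ?_ ?_) hy0.le
          · linarith [hy.1]
          · nlinarith [hy.2]
      · rw [← hFM]
        refine antitoneOn_of_deriv_nonpos (convex_Icc x M)
          (hc.mono fun y hy => lt_of_lt_of_le hx hy.1)
          (fun y hy => ((hd y ?_).differentiableAt).differentiableWithinAt) (fun y hy => ?_)
          (Set.left_mem_Icc.mpr hxM) (Set.right_mem_Icc.mpr hxM) hxM
        · rw [interior_Icc] at hy; exact hx.trans hy.1
        · rw [interior_Icc] at hy
          have hy0 : 0 < y := hx.trans hy.1
          rw [(hd y hy0).deriv]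
          refine div_nonpos_of_nonpos_of_nonneg (mul_nonpos_of_nonneg_of_nonpos ?_ ?_) hy0.le
          · linarith [hy.1]
          · nlinarith [hy.1]
  rw [kappa, ← hv, div_mul_eq_mul_div, le_div_iff₀ hv0]
  simp only [hF] at key
  linarith

lemma kappa_nonneg {M : ℝ} (hM : 1 < M) : 0 ≤ kappa M :=
  div_nonneg (sq_nonneg _) (sub_one_sub_log_pos hM).le

lemma le_sigmoid_of_le {R z : ℝ} (h : -R ≤ z) : (1 + Real.exp R)⁻¹ ≤ Real.sigmoid z := by
  have := Real.sigmoid_le h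
  rwa [Real.sigmoid_def, neg_neg] at this

/-- Mean value theorem: `σ'(z) = σ(z) σ(-z)`, and both factors are at least `(1 + e^R)⁻¹` on `[-R,
R]`. -/
lemma mul_sub_sq_le_sigmoid_sub_sq {R x y : ℝ} (hx : |x| ≤ R) (hy : |y| ≤ R) :
    (((1 + Real.exp R) ^ 2)⁻¹) ^ 2 * (x - y) ^ 2 ≤ (Real.sigmoid x - Real.sigmoid y) ^ 2 := by
  wlog h : y ≤ x generalizing x y
  · have := this hy hx (le_of_not_ge h)
    rwa [← neg_sub x y, ← neg_sub (Real.sigmoid x), neg_sq, neg_sq] at this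
  rw [abs_le] at hx hy
  have key := (convex_Icc (-R) R).mul_sub_le_image_sub_of_le_deriv (f := Real.sigmoid)
    continuous_sigmoid.continuousOn differentiable_sigmoid.differentiableOn
    (C := ((1 + Real.exp R) ^ 2)⁻¹) (fun z hz => by
      rw [interior_Icc] at hz
      rw [(Real.hasDerivAt_sigmoid z).deriv, ← Real.sigmoid_neg, pow_two, mul_inv]
      have : 0 < 1 + Real.exp R := by positivity
      exact mul_le_mul (le_sigmoid_of_le hz.1.le) (le_sigmoid_of_le (by linarith [hz.2]))
        (by positivity) (Real.sigmoid_nonneg _)) y hy x hx h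
  rw [← mul_pow]
  exact pow_le_pow_left₀ (mul_nonneg (by positivity) (by linarith)) key 2

/-- One minus the left side is half the sum of the squared differences of square roots. Since `p - q
= (√p - √q)(√p + √q)` and the last factor is at most 2, each of these squares is at least `(p -
q)²/4`. -/
lemma bhattacharyya_le {p q : ℝ} (hp : p ∈ Set.Icc 0 1) (hq : q ∈ Set.Icc 0 1) :
    √p * √q + √(1 - p) * √(1 - q) ≤ 1 - (p - q) ^ 2 / 4 := by
  have h1 := Real.sq_sqrt hp.1
  have h2 := Real.sq_sqrt hq.1
  have h3 := Real.sq_sqrt (sub_nonneg.mpr hp.2)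
  have h4 := Real.sq_sqrt (sub_nonneg.mpr hq.2)
  have b1 : √p ≤ 1 := Real.sqrt_le_one.mpr hp.2
  have b2 : √q ≤ 1 := Real.sqrt_le_one.mpr hq.2
  have b3 : √(1 - p) ≤ 1 := Real.sqrt_le_one.mpr (by linarith [hp.1])
  have b4 : √(1 - q) ≤ 1 := Real.sqrt_le_one.mpr (by linarith [hq.1])
  have n1 := Real.sqrt_nonneg p
  have n2 := Real.sqrt_nonneg q
  have n3 := Real.sqrt_nonneg (1 - p)
  have n4 := Real.sqrt_nonneg (1 - q)
  generalize √p = a at *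
  generalize √q = b at *
  generalize √(1 - p) = a' at *
  generalize √(1 - q) = b' at *
  have e1 : (p - q) ^ 2 ≤ 4 * (a - b) ^ 2 := by
    rw [← h1, ← h2, sq_sub_sq, mul_pow]
    exact mul_le_mul_of_nonneg_right (by nlinarith) (sq_nonneg _)
  have e2 : (p - q) ^ 2 ≤ 4 * (a' - b') ^ 2 := by
    have : (p - q) ^ 2 = (a' ^ 2 - b' ^ 2) ^ 2 := by rw [h3, h4]; ring
    rw [this, sq_sub_sq, mul_pow]
    exact mul_le_mul_of_nonneg_right (by nlinarith) (sq_nonneg _)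
  nlinarith

/-! ### Expectations over prompts -/

/-- A bounded real function of the prompt. -/
def Bdd {S : Type*} (φ : S → ℝ) : Prop := ∃ B, ∀ s, |φ s| ≤ B

namespace Bdd

variable {S : Type*} {φ ψ : S → ℝ}

lemma const (c : ℝ) : Bdd fun _ : S => c := ⟨|c|, fun _ => le_rfl⟩

lemma add (h : Bdd φ) (h' : Bdd ψ) : Bdd fun s => φ s + ψ s := by
  obtain ⟨B, hB⟩ := h
  obtain ⟨B', hB'⟩ := h'
  exact ⟨B + B', fun s => (abs_add_le _ _).trans (add_le_add (hB s) (hB' s))⟩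

lemma mul (h : Bdd φ) (h' : Bdd ψ) : Bdd fun s => φ s * ψ s := by
  obtain ⟨B, hB⟩ := h
  obtain ⟨B', hB'⟩ := h'
  refine ⟨B * B', fun s => ?_⟩
  rw [abs_mul]
  exact mul_le_mul (hB s) (hB' s) (abs_nonneg _) ((abs_nonneg _).trans (hB s))

lemma neg (h : Bdd φ) : Bdd fun s => -φ s := by
  obtain ⟨B, hB⟩ := h
  exact ⟨B, fun s => by rw [abs_neg]; exact hB s⟩

lemma sub (h : Bdd φ) (h' : Bdd ψ) : Bdd fun s => φ s - ψ s := by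
  simpa only [sub_eq_add_neg] using h.add h'.neg

lemma sum {ι : Type*} (I : Finset ι) {f : ι → S → ℝ} (h : ∀ i ∈ I, Bdd (f i)) :
    Bdd fun s => ∑ i ∈ I, f i s := by
  induction I using Finset.induction_on with
  | empty => simpa using const (S := S) 0
  | insert a I ha ih =>
    simp only [Finset.sum_insert ha]
    exact (h a (by simp)).add (ih fun i hi => h i (by simp [hi]))

lemma of_mem_Icc {a b : ℝ} (h : ∀ s, φ s ∈ Set.Icc a b) : Bdd φ :=
  ⟨max |a| |b|, fun s => by
    rw [abs_le]
    constructor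
    · linarith [(h s).1, le_max_left |a| |b|, neg_abs_le a]
    · linarith [(h s).2, le_max_right |a| |b|, le_abs_self b]⟩

lemma pow (h : Bdd φ) (n : ℕ) : Bdd fun s => φ s ^ n := by
  induction n with
  | zero => simpa using const (S := S) 1
  | succ n ih => simpa only [pow_succ] using ih.mul h

end Bdd

namespace Problem

variable {S A : Type*} [Fintype A] (P : Problem S A)

/-- `𝔼_{s ∼ ρ}[φ(s)]`. -/
def mean (φ : S → ℝ) : ℝ := ∑' s, (P.ρ s).toReal * φ s

lemma hasSum_ρ : HasSum (fun s => (P.ρ s).toReal) 1 := by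
  have := ENNReal.hasSum_toReal (f := fun s => P.ρ s) P.ρ.tsum_coe_ne_top
  rwa [← ENNReal.tsum_toReal_eq (fun s => P.ρ.apply_ne_top s), P.ρ.tsum_coe,
    ENNReal.toReal_one] at this

variable {P} {φ ψ : S → ℝ}

/-- The prompt set may be infinite, so linearity and monotonicity of `mean` need summability; this
is why `Bdd` proofs accompany every integrand below. -/
lemma summable_mean (h : Bdd φ) : Summable fun s => (P.ρ s).toReal * φ s := by
  obtain ⟨B, hB⟩ := h
  refine Summable.of_norm_bounded (g := fun s => (P.ρ s).toReal * B)
    (P.hasSum_ρ.summable.mul_right B) fun s => ?_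
  rw [norm_mul, Real.norm_eq_abs, Real.norm_eq_abs, abs_of_nonneg ENNReal.toReal_nonneg]
  exact mul_le_mul_of_nonneg_left (hB s) ENNReal.toReal_nonneg

lemma mean_const (c : ℝ) : P.mean (fun _ => c) = c := by
  rw [mean, tsum_mul_right, P.hasSum_ρ.tsum_eq, one_mul]

lemma mean_add (h : Bdd φ) (h' : Bdd ψ) :
    P.mean (fun s => φ s + ψ s) = P.mean φ + P.mean ψ := by
  simp only [mean, mul_add]
  exact (summable_mean h).tsum_add (summable_mean h')

lemma mean_mul_left (c : ℝ) : P.mean (fun s => c * φ s) = c * P.mean φ := by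
  simp only [mean, mul_left_comm _ c]
  exact tsum_mul_left

lemma mean_sub (h : Bdd φ) (h' : Bdd ψ) :
    P.mean (fun s => φ s - ψ s) = P.mean φ - P.mean ψ := by
  simp only [mean, mul_sub]
  exact (summable_mean h).tsum_sub (summable_mean h')

lemma mean_mono (h : Bdd φ) (h' : Bdd ψ) (hle : ∀ s, φ s ≤ ψ s) : P.mean φ ≤ P.mean ψ :=
  (summable_mean h).tsum_le_tsum
    (fun s => mul_le_mul_of_nonneg_left (hle s) ENNReal.toReal_nonneg) (summable_mean h')

lemma mean_nonneg (hle : ∀ s, 0 ≤ φ s) : 0 ≤ P.mean φ :=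
  tsum_nonneg fun s => mul_nonneg ENNReal.toReal_nonneg (hle s)

lemma mean_sum {ι : Type*} (I : Finset ι) {f : ι → S → ℝ} (h : ∀ i ∈ I, Bdd (f i)) :
    P.mean (fun s => ∑ i ∈ I, f i s) = ∑ i ∈ I, P.mean (f i) := by
  simp only [mean, Finset.mul_sum]
  exact Summable.tsum_finsetSum fun i hi => summable_mean (h i hi)

lemma tsum_ρ_mul_ofReal (h : Bdd φ) (h0 : ∀ s, 0 ≤ φ s) :
    ∑' s, P.ρ s * ENNReal.ofReal (φ s) = ENNReal.ofReal (P.mean φ) := by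
  rw [mean, ENNReal.ofReal_tsum_of_nonneg
    (fun s => mul_nonneg ENNReal.toReal_nonneg (h0 s)) (summable_mean h)]
  refine tsum_congr fun s => ?_
  rw [ENNReal.ofReal_mul ENNReal.toReal_nonneg, ENNReal.ofReal_toReal (P.ρ.apply_ne_top s)]

variable (P) in
lemma expect_eq_mean (π : Policy S A) (f : S → A → ℝ) :
    P.expect π f = P.mean fun s => ∑ a, π s a * f s a := rfl

end Problem

namespace Problem

variable {S A : Type*} [Fintype A] {P : Problem S A} {Pi : Finset (Policy S A)}

/-! ### Policies with bounded density ratio -/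

variable (P) in
/-- The density ratio of `π` to the reference policy lies in `[e^{-R/β}, e^{R/β}]`. -/
def Band (π : Policy S A) : Prop := ∀ s a,
  Real.exp (-(P.R / P.β)) * P.πref s a ≤ π s a ∧ π s a ≤ Real.exp (P.R / P.β) * P.πref s a

lemma sum_policy (π : Policy S A) (s : S) : ∑ a, π s a = 1 := (π s).2.2

lemma policy_nonneg (π : Policy S A) (s : S) (a : A) : 0 ≤ π s a := (π s).2.1 a

lemma policy_le_one (π : Policy S A) (s : S) (a : A) : π s a ≤ 1 := by
  rw [← sum_policy π s]
  exact Finset.single_le_sum (fun b _ => policy_nonneg π s b) (Finset.mem_univ a)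

lemma bdd_policy (π : Policy S A) (a : A) : Bdd fun s => π s a :=
  Bdd.of_mem_Icc fun s => ⟨policy_nonneg π s a, policy_le_one π s a⟩

lemma bdd_sum_policy (π : Policy S A) {f : S → A → ℝ} (h : ∀ a, Bdd fun s => f s a) :
    Bdd fun s => ∑ a, π s a * f s a :=
  Bdd.sum _ fun a _ => (bdd_policy π a).mul (h a)

/-- Written without logarithms, the ratio bound is a family of linear inequalities in `π`, so it
passes from `Π` to the convex hull. -/
lemma band_of_mem_conv (hPi : P.PolicyClass Pi) {π : Policy S A} (h : π ∈ conv Pi) :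
    P.Band π := by
  have hconv : Convex ℝ {f : S → A → ℝ | ∀ s a,
      Real.exp (-(P.R / P.β)) * P.πref s a ≤ f s a ∧
        f s a ≤ Real.exp (P.R / P.β) * P.πref s a} := by
    simp only [Set.ofPred_forall]
    refine convex_iInter fun s => convex_iInter fun a => ?_
    intro x hx y hy u v hu hv huv
    simp only [Set.mem_ofPred_eq] at hx hy
    change _ ≤ u * x s a + v * y s a ∧ u * x s a + v * y s a ≤ _
    constructor
    · rw [← one_mul (Real.exp _ * _), ← huv, add_mul]
      exact add_le_add (mul_le_mul_of_nonneg_left hx.1 hu) (mul_le_mul_of_nonneg_left hy.1 hv)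
    · rw [← one_mul (Real.exp _ * _), ← huv, add_mul]
      exact add_le_add (mul_le_mul_of_nonneg_left hx.2 hu) (mul_le_mul_of_nonneg_left hy.2 hv)
  refine convexHull_min ?_ hconv h
  rintro _ ⟨π', hπ', rfl⟩ s a
  obtain ⟨h0, hb⟩ := hPi.bounded_ratio π' hπ' s a
  have hr := P.πref_pos s a
  rw [abs_le, Real.le_log_iff_exp_le (div_pos h0 hr), Real.log_le_iff_le_exp (div_pos h0 hr),
    le_div_iff₀ hr, div_le_iff₀ hr] at hb
  exact hb

lemma mem_conv_of_mem {π : Policy S A} (h : π ∈ Pi) : π ∈ conv Pi :=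
  subset_convexHull _ _ ⟨π, h, rfl⟩

namespace Band

variable {π π' : Policy S A}

lemma pos (h : P.Band π) (s : S) (a : A) : 0 < π s a :=
  (mul_pos (Real.exp_pos _) (P.πref_pos s a)).trans_le (h s a).1

lemma bdd_log (h : P.Band π) (a : A) : Bdd fun s => Real.log (π s a / P.πref s a) := by
  have hr := fun s => P.πref_pos s a
  refine Bdd.of_mem_Icc (a := -(P.R / P.β)) (b := P.R / P.β) fun s => ?_
  rw [Set.mem_Icc, Real.le_log_iff_exp_le (div_pos (h.pos s a) (hr s)),
    Real.log_le_iff_le_exp (div_pos (h.pos s a) (hr s)), le_div_iff₀ (hr s), div_le_iff₀ (hr s)]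
  exact h s a

lemma div_le (h : P.Band π) (h' : P.Band π') (s : S) (a : A) :
    π' s a / π s a ≤ Real.exp (2 * P.R / P.β) := by
  rw [div_le_iff₀ (h.pos s a)]
  calc π' s a ≤ Real.exp (P.R / P.β) * P.πref s a := (h' s a).2
    _ = Real.exp (2 * P.R / P.β) * (Real.exp (-(P.R / P.β)) * P.πref s a) := by
      rw [← mul_assoc, ← Real.exp_add]; ring_nf
    _ ≤ _ := mul_le_mul_of_nonneg_left (h s a).1 (Real.exp_pos _).le

lemma bdd_div (h : P.Band π) (h' : P.Band π') (a : A) : Bdd fun s => π' s a / π s a :=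
  Bdd.of_mem_Icc fun s => ⟨div_nonneg (policy_nonneg π' s a) (policy_nonneg π s a), h.div_le h' s a⟩

end Band

/-! ### The optimality gap -/

variable (P) in
/-- The optimal policy for the ground-truth reward. -/
abbrev πstar : Policy S A := P.optPolicy P.rstar

variable (P) in
-- The shift `z` is `β` times the log-partition function.
lemma exists_log_πstar : ∃ z : S → ℝ, ∀ s a,
    P.β * Real.log (P.πstar s a / P.πref s a) = P.rstar s a - z s := by
  refine ⟨fun s => P.β * Real.log (∑ b, P.πref s b * Real.exp (P.rstar s b / P.β)),
    fun s a => ?_⟩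
  have hr := P.πref_pos s a
  have hZ : 0 < ∑ b, P.πref s b * Real.exp (P.rstar s b / P.β) :=
    Finset.sum_pos (fun b _ => mul_pos (P.πref_pos s b) (Real.exp_pos _)) ⟨a, Finset.mem_univ a⟩
  have e : P.πstar s a / P.πref s a =
      Real.exp (P.rstar s a / P.β) / ∑ b, P.πref s b * Real.exp (P.rstar s b / P.β) := by
    change P.πref s a * Real.exp (P.rstar s a / P.β) / _ / _ = _
    field_simp
  rw [e, Real.log_div (Real.exp_pos _).ne' hZ.ne', Real.log_exp]
  have := P.β_pos.ne'
  field_simp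

lemma band_πstar (hPi : P.PolicyClass Pi) : P.Band P.πstar :=
  band_of_mem_conv hPi (mem_conv_of_mem hPi.realizable)

lemma bdd_rstar (a : A) : Bdd fun s => P.rstar s a := Bdd.of_mem_Icc fun s => P.rstar_mem s a

variable (P) in
/-- The pointwise divergence `x - 1 - log x` of `π*` from `π`, weighted by `π`. -/
def divg (π : Policy S A) (s : S) : ℝ :=
  ∑ a, π s a * (P.πstar s a / π s a - 1 - Real.log (P.πstar s a / π s a))

/-- The terms `π* - π` sum to zero over the responses; what remains is `KL(π‖π*)` at the prompt `s`.
-/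
lemma divg_eq {π : Policy S A} (hπ : P.Band π) (h : P.Band P.πstar) (s : S) :
    P.divg π s = ∑ a, (π s a * Real.log (π s a / P.πref s a)
      - π s a * Real.log (P.πstar s a / P.πref s a)) := by
  have h1 : ∑ a, (P.πstar s a - π s a) = 0 := by
    rw [Finset.sum_sub_distrib, sum_policy, sum_policy, sub_self]
  rw [divg, ← sub_eq_zero, ← Finset.sum_sub_distrib, ← h1]
  refine Finset.sum_congr rfl fun a _ => ?_
  have e1 := (hπ.pos s a).ne'
  have e2 := (h.pos s a).ne'
  have e3 := (P.πref_pos s a).ne'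
  rw [Real.log_div e2 e1, Real.log_div e1 e3, Real.log_div e2 e3]
  field_simp
  ring

lemma bdd_divg {π : Policy S A} (hπ : P.Band π) (h : P.Band P.πstar) : Bdd (P.divg π) := by
  rw [funext (divg_eq hπ h)]
  exact Bdd.sum _ fun a _ => ((bdd_policy π a).mul (hπ.bdd_log a)).sub
    ((bdd_policy π a).mul (h.bdd_log a))

lemma divg_nonneg {π : Policy S A} (hπ : P.Band π) (h : P.Band P.πstar) (s : S) :
    0 ≤ P.divg π s :=
  Finset.sum_nonneg fun a _ => mul_nonneg (hπ.pos s a).le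
    (sub_one_sub_log_nonneg (div_pos (h.pos s a) (hπ.pos s a)))

lemma J_eq {π : Policy S A} (hπ : P.Band π) :
    P.J π = P.mean fun s =>
      ∑ a, (π s a * P.rstar s a - P.β * (π s a * Real.log (π s a / P.πref s a))) := by
  rw [J, kl, expect_eq_mean, expect_eq_mean, ← mean_mul_left,
    ← mean_sub (bdd_sum_policy π bdd_rstar)
      ((Bdd.const _).mul (bdd_sum_policy π hπ.bdd_log))]
  congr 1
  funext s
  rw [Finset.mul_sum, Finset.sum_sub_distrib]

lemma bdd_J_integrand {π : Policy S A} (hπ : P.Band π) :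
    Bdd fun s => ∑ a, (π s a * P.rstar s a - P.β * (π s a * Real.log (π s a / P.πref s a))) :=
  Bdd.sum _ fun a _ => ((bdd_policy π a).mul (bdd_rstar a)).sub
    ((Bdd.const _).mul ((bdd_policy π a).mul (hπ.bdd_log a)))

/-- After substituting `r* = β log(π*/πref) + z`, the integrand of `J(π*)` is `z` and that of `J(π)`
is `z - β KL(π‖π*)`. -/
lemma gap_eq {π : Policy S A} (hπ : P.Band π) (h : P.Band P.πstar) :
    P.gap π = P.β * P.mean (P.divg π) := by
  obtain ⟨z, hz⟩ := P.exists_log_πstar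
  rw [gap, J_eq h, J_eq hπ, ← mean_sub (bdd_J_integrand h) (bdd_J_integrand hπ), ← mean_mul_left]
  congr 1
  funext s
  have hr : ∀ a, P.rstar s a = P.β * Real.log (P.πstar s a / P.πref s a) + z s := fun a => by
    rw [hz]; ring
  have e1 : ∑ a, (P.πstar s a * P.rstar s a -
      P.β * (P.πstar s a * Real.log (P.πstar s a / P.πref s a))) = z s := by
    rw [← one_mul (z s), ← sum_policy P.πstar s, Finset.sum_mul]
    refine Finset.sum_congr rfl fun a _ => ?_
    rw [hr]; ring
  have e2 : ∑ a, (π s a * P.rstar s a - P.β * (π s a * Real.log (π s a / P.πref s a))) =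
      z s - P.β * P.divg π s := by
    rw [divg_eq hπ h, Finset.mul_sum, ← one_mul (z s), ← sum_policy π s, Finset.sum_mul,
      ← Finset.sum_sub_distrib]
    refine Finset.sum_congr rfl fun a _ => ?_
    rw [hr]; ring
  rw [e1, e2]
  ring

lemma gap_nonneg (hPi : P.PolicyClass Pi) {π : Policy S A} (hπ : π ∈ conv Pi) : 0 ≤ P.gap π := by
  have hb := band_of_mem_conv hPi hπ
  have hs := band_πstar hPi
  rw [gap_eq hb hs]
  exact mul_nonneg P.β_pos.le (mean_nonneg (divg_nonneg hb hs))

/-- The coverage of `π*` by `π` is controlled by the gap of `π`. -/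
lemma expect_sq_ratio_le (hPi : P.PolicyClass Pi) {π : Policy S A} (hπ : π ∈ conv Pi) :
    P.expect π (fun s a => (P.πstar s a / π s a) ^ 2) ≤
      1 + kappa (Real.exp (2 * P.R / P.β)) / P.β * P.gap π := by
  have hb := band_of_mem_conv hPi hπ
  have hs := band_πstar hPi
  have hM : 1 < Real.exp (2 * P.R / P.β) :=
    Real.one_lt_exp_iff.mpr (div_pos (mul_pos two_pos P.R_pos) P.β_pos)
  set κ := kappa (Real.exp (2 * P.R / P.β))
  have e : 1 + κ / P.β * P.gap π = P.mean fun s => 1 + κ * P.divg π s := by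
    rw [gap_eq hb hs, mean_add (Bdd.const 1) ((Bdd.const _).mul (bdd_divg hb hs)), mean_const,
      mean_mul_left]
    have := P.β_pos.ne'
    field_simp
  rw [e, expect_eq_mean]
  refine mean_mono (bdd_sum_policy π fun a => (hb.bdd_div hs a).pow 2)
    ((Bdd.const 1).add ((Bdd.const _).mul (bdd_divg hb hs))) fun s => ?_
  -- Expanding the square, `π (x-1)² = π x² - (2π* - π)` with `x = π*/π`. Both policies have mass
  -- one, so the subtracted terms sum to 1.
  have e1 : (1 : ℝ) = ∑ a, (2 * P.πstar s a - π s a) := by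
    rw [Finset.sum_sub_distrib, ← Finset.mul_sum, sum_policy, sum_policy]; norm_num
  suffices H : ∑ a, π s a * (P.πstar s a / π s a) ^ 2 ≤
      ∑ a, (2 * P.πstar s a - π s a) + κ * P.divg π s by rwa [← e1] at H
  rw [divg, Finset.mul_sum, ← Finset.sum_add_distrib]
  refine Finset.sum_le_sum fun a _ => ?_
  have h0 := hb.pos s a
  have key := mul_le_mul_of_nonneg_left (sq_sub_one_le_kappa_mul hM
    (div_pos (hs.pos s a) h0) (hb.div_le hs s a)) h0.le
  have e2 : π s a * (P.πstar s a / π s a - 1) ^ 2 =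
      π s a * (P.πstar s a / π s a) ^ 2 - (2 * P.πstar s a - π s a) := by
    field_simp; ring
  rw [e2] at key
  linarith

/-- The uniform mixture of policies of `conv(Π)` is in `conv(Π)`, and its gap is at most the
average gap. -/
lemma exists_average (hPi : P.PolicyClass Pi) {ι : Type*} {I : Finset ι} (hI : I.Nonempty)
    {pol : ι → Policy S A} (h : ∀ i ∈ I, pol i ∈ conv Pi) :
    ∃ π ∈ conv Pi, (∀ s a, π s a = ∑ i ∈ I, (I.card : ℝ)⁻¹ * pol i s a) ∧
      P.gap π ≤ (I.card : ℝ)⁻¹ * ∑ i ∈ I, P.gap (pol i) := by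
  have hm : (0 : ℝ) < I.card := by exact_mod_cast hI.card_pos
  have hw0 : ∀ i ∈ I, 0 ≤ (I.card : ℝ)⁻¹ := fun _ _ => by positivity
  have hw1 : ∑ _i ∈ I, (I.card : ℝ)⁻¹ = 1 := by
    rw [Finset.sum_const, nsmul_eq_mul, mul_inv_cancel₀ hm.ne']
  let π : Policy S A := fun s => ⟨fun a => ∑ i ∈ I, (I.card : ℝ)⁻¹ * pol i s a,
    fun a => Finset.sum_nonneg fun i hi => mul_nonneg (hw0 i hi) (policy_nonneg _ _ _), by
      rw [Finset.sum_comm]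
      simp only [← Finset.mul_sum, sum_policy]
      simpa using inv_mul_cancel₀ hm.ne'⟩
  have hπ : ∀ s a, π s a = ∑ i ∈ I, (I.card : ℝ)⁻¹ * pol i s a := fun s a => rfl
  have hc : π ∈ conv Pi := by
    have := (convex_convexHull ℝ ((fun (π' : Policy S A) (s : S) (a : A) => π' s a) ''
      (Pi : Set (Policy S A)))).sum_mem (t := I) hw0 hw1 (z := fun i s a => pol i s a) h
    rw [conv, Set.mem_ofPred_eq]
    convert this using 1
    funext s a
    simp [hπ]
  refine ⟨π, hc, hπ, ?_⟩
  have hs := band_πstar hPi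
  have hb := band_of_mem_conv hPi hc
  have hbi := fun i hi => band_of_mem_conv hPi (h i hi)
  rw [gap_eq hb hs, Finset.sum_congr rfl fun i hi => gap_eq (hbi i hi) hs, ← Finset.mul_sum,
    mul_left_comm, ← mean_sum I fun i hi => bdd_divg (hbi i hi) hs,
    ← mean_mul_left (I.card : ℝ)⁻¹]
  refine mul_le_mul_of_nonneg_left (mean_mono (bdd_divg hb hs)
    ((Bdd.const _).mul (Bdd.sum _ fun i hi => bdd_divg (hbi i hi) hs)) fun s => ?_) P.β_pos.le
  -- The reference policy cancels, leaving a term convex in `π'` and a term linear in `π'`; Jensen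
  -- for `u log u` is then enough.
  have e : ∀ π' : Policy S A, P.Band π' → P.divg π' s =
      ∑ a, (π' s a * Real.log (π' s a) - π' s a * Real.log (P.πstar s a)) := fun π' h' => by
    rw [divg_eq h' hs]
    refine Finset.sum_congr rfl fun a _ => ?_
    rw [Real.log_div (h'.pos s a).ne' (P.πref_pos s a).ne',
      Real.log_div (hs.pos s a).ne' (P.πref_pos s a).ne']
    ring
  rw [e π hb, Finset.sum_congr rfl fun i hi => e (pol i) (hbi i hi), Finset.sum_comm,
    Finset.mul_sum]
  refine Finset.sum_le_sum fun a _ => ?_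
  have hj := Real.convexOn_mul_log.map_sum_le hw0 hw1 (p := fun i => pol i s a)
    fun i _ => policy_nonneg (pol i) s a
  simp only [smul_eq_mul] at hj
  rw [hπ, Finset.sum_sub_distrib, mul_sub, Finset.mul_sum, Finset.mul_sum]
  refine sub_le_sub hj (le_of_eq ?_)
  rw [Finset.sum_mul]
  exact Finset.sum_congr rfl fun i _ => (mul_assoc _ _ _).symm

/-! ### Rewards of policies -/

lemma rewardOf_mem (π : Policy S A) (s : S) (a : A) : P.rewardOf π s a ∈ Set.Icc 0 P.R :=
  ⟨le_max_left _ _, max_le P.R_pos.le (min_le_left _ _)⟩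

/-- The partition function cancels against the infimum, and the clip is inactive because `r* - min
r*` already lies in `[0, R]`. Hence the class contains a reward with the true differences between
responses, the only feature of `r*` seen by the labels. -/
lemma exists_rewardOf_πstar_eq (P : Problem S A) : ∃ μ : S → ℝ, ∀ s a,
    P.rewardOf P.πstar s a = P.rstar s a - μ s := by
  obtain ⟨z, hz⟩ := P.exists_log_πstar
  refine ⟨fun s => ⨅ a', P.rstar s a', fun s a => ?_⟩
  have hbdd : BddBelow (Set.range fun a' => P.rstar s a') := (Set.finite_range _).bddBelow
  have : Nonempty A := ⟨a⟩
  have e : ⨅ a', (P.rstar s a' - z s) = (⨅ a', P.rstar s a') - z s := by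
    simp only [sub_eq_add_neg]
    exact (ciInf_add hbdd _).symm
  simp only [rewardOf, hz, e, sub_sub_sub_cancel_right]
  have h1 : ⨅ a', P.rstar s a' ≤ P.rstar s a := ciInf_le hbdd a
  have h2 : 0 ≤ ⨅ a', P.rstar s a' := le_ciInf fun a' => (P.rstar_mem s a').1
  rw [min_eq_right (by linarith [(P.rstar_mem s a).2]), max_eq_right (by linarith)]

/-! ### Relative reward errors and the offline max-min guarantee. -/

variable (P) in
/-- `𝔼_{s ∼ ρ, a ∼ π, ã ∼ πref}[f(s, a, ã)]`. -/
def pairMean (π : Policy S A) (f : S → A → A → ℝ) : ℝ :=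
  P.expect π fun s a => ∑ a', P.πref s a' * f s a a'

variable (P) in
/-- The difference of the relative rewards of the optimal policy's reward and `r`. -/
def relDiff (r : S → A → ℝ) (s : S) (a a' : A) : ℝ :=
  (P.rewardOf P.πstar s a - P.rewardOf P.πstar s a') - (r s a - r s a')

lemma bdd_rewardOf (π : Policy S A) (a : A) : Bdd fun s => P.rewardOf π s a :=
  Bdd.of_mem_Icc fun s => rewardOf_mem π s a

lemma bdd_of_mem_rewardClass {r : S → A → ℝ} (h : r ∈ P.rewardClass Pi) (a : A) :
    Bdd fun s => r s a := by
  obtain ⟨π, -, rfl⟩ := h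
  exact bdd_rewardOf π a

lemma bdd_relDiff {r : S → A → ℝ} (h : r ∈ P.rewardClass Pi) (a a' : A) :
    Bdd fun s => P.relDiff r s a a' :=
  ((bdd_rewardOf _ a).sub (bdd_rewardOf _ a')).sub
    ((bdd_of_mem_rewardClass h a).sub (bdd_of_mem_rewardClass h a'))

lemma pairMean_mono {π π' : Policy S A} {f f' : S → A → A → ℝ}
    (hf : ∀ a a', Bdd fun s => f s a a') (hf' : ∀ a a', Bdd fun s => f' s a a')
    (hle : ∀ s a a', π s a * f s a a' ≤ π' s a * f' s a a') :
    P.pairMean π f ≤ P.pairMean π' f' := by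
  refine mean_mono (bdd_sum_policy π fun a => bdd_sum_policy P.πref fun a' => hf a a')
    (bdd_sum_policy π' fun a => bdd_sum_policy P.πref fun a' => hf' a a')
    fun s => Finset.sum_le_sum fun a _ => ?_
  rw [Finset.mul_sum, Finset.mul_sum]
  refine Finset.sum_le_sum fun a' _ => ?_
  have := mul_le_mul_of_nonneg_left (hle s a a') (P.πref_pos s a').le
  linarith

lemma pairMean_nonneg (π : Policy S A) {f : S → A → A → ℝ} (hf : ∀ s a a', 0 ≤ f s a a') :
    0 ≤ P.pairMean π f :=
  mean_nonneg fun s => Finset.sum_nonneg fun a _ => mul_nonneg (policy_nonneg π s a)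
    (Finset.sum_nonneg fun a' _ => mul_nonneg (P.πref_pos s a').le (hf s a a'))

lemma pairMean_add_mul (π : Policy S A) {w : S → A → ℝ} {f : S → A → A → ℝ} (c c' : ℝ)
    (hw : ∀ a, Bdd fun s => w s a) (hf : ∀ a a', Bdd fun s => f s a a') :
    P.pairMean π (fun s a a' => c * w s a + c' * f s a a') =
      c * P.expect π w + c' * P.pairMean π f := by
  rw [pairMean, pairMean, expect_eq_mean, expect_eq_mean, expect_eq_mean, ← mean_mul_left,
    ← mean_mul_left, ← mean_add ((Bdd.const c).mul (bdd_sum_policy π hw)) ((Bdd.const c').mul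
      (bdd_sum_policy π fun a => bdd_sum_policy P.πref fun a' => hf a a'))]
  congr 1
  funext s
  rw [Finset.mul_sum, Finset.mul_sum, ← Finset.sum_add_distrib]
  refine Finset.sum_congr rfl fun a _ => ?_
  have : ∑ a', P.πref s a' * (c * w s a + c' * f s a a') =
      c * w s a + c' * ∑ a', P.πref s a' * f s a a' := by
    have h1 : c * w s a = ∑ a', P.πref s a' * (c * w s a) := by
      rw [← Finset.sum_mul, sum_policy, one_mul]
    rw [Finset.mul_sum, h1, ← Finset.sum_add_distrib]
    refine Finset.sum_congr rfl fun a' _ => ?_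
    rw [← h1]
    ring
  rw [this]
  ring

lemma expect_one (π : Policy S A) : P.expect π (fun _ _ => 1) = 1 := by
  simp only [expect_eq_mean, mul_one, sum_policy, mean_const]

lemma pairMean_average {ι : Type*} {I : Finset ι} {c : ℝ} {pol : ι → Policy S A}
    {π : Policy S A} (hπ : ∀ s a, π s a = ∑ i ∈ I, c * pol i s a) {f : S → A → A → ℝ}
    (hf : ∀ a a', Bdd fun s => f s a a') :
    P.pairMean π f = c * ∑ i ∈ I, P.pairMean (pol i) f := by
  simp only [pairMean, expect_eq_mean]
  rw [← mean_sum I fun i _ => bdd_sum_policy (pol i) fun a => bdd_sum_policy P.πref fun a' => hf a a',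
    ← mean_mul_left]
  congr 1
  funext s
  rw [Finset.sum_comm, Finset.mul_sum]
  refine Finset.sum_congr rfl fun a _ => ?_
  rw [hπ, Finset.sum_mul, Finset.mul_sum]
  exact Finset.sum_congr rfl fun i _ => mul_assoc _ _ _

/-- The guarantee of the offline max-min solution against a competitor of `conv(Π)`. -/
lemma IsRPO.gap_le (hPi : P.PolicyClass Pi) {D : Dataset S A} {η : ℝ} (hη : 0 < η)
    {π πc : Policy S A} {r : S → A → ℝ} (h : P.IsRPO Pi D η π r) (hc : πc ∈ conv Pi) :
    ∃ r' ∈ P.rewardClass Pi, P.gap π ≤ P.gap πc + P.pairMean πc (P.relDiff r') +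
      (nll D (P.rewardOf P.πstar) - nll D r') / η := by
  obtain ⟨-, -, h1, h2⟩ := h
  obtain ⟨r', hr', hle⟩ := h2 πc hc
  refine ⟨r', hr', ?_⟩
  -- Outer optimality compares `πc` at `r'` with `π` at `r`; inner optimality then replaces `r` by
  -- the realizable reward.
  have h3 := hle.trans (h1 _ ⟨_, hPi.realizable, rfl⟩)
  obtain ⟨μ, hμ⟩ := exists_rewardOf_πstar_eq P
  have hrw : ∀ π' : Policy S A, ∀ a, Bdd fun s => P.rewardOf π' s a := bdd_rewardOf
  -- The prompt-dependent shift `μ` has the same mean under both policies.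
  have e1 : P.expect πc P.rstar - P.expect π P.rstar =
      P.expect πc (P.rewardOf P.πstar) - P.expect π (P.rewardOf P.πstar) := by
    rw [expect_eq_mean, expect_eq_mean, expect_eq_mean, expect_eq_mean,
      ← mean_sub (bdd_sum_policy _ bdd_rstar) (bdd_sum_policy _ bdd_rstar),
      ← mean_sub (bdd_sum_policy _ (hrw _)) (bdd_sum_policy _ (hrw _))]
    congr 1
    funext s
    simp only [hμ, mul_sub, Finset.sum_sub_distrib, ← Finset.sum_mul, sum_policy]
    ring
  have hb := fun a => bdd_of_mem_rewardClass hr' a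
  have e2 : P.pairMean πc (P.relDiff r') = (P.expect πc (P.rewardOf P.πstar) -
      P.expect P.πref (P.rewardOf P.πstar)) - (P.expect πc r' - P.expect P.πref r') := by
    rw [expect_eq_mean, expect_eq_mean, expect_eq_mean, expect_eq_mean,
      ← mean_sub (bdd_sum_policy _ (hrw _)) (bdd_sum_policy _ (hrw _)),
      ← mean_sub (bdd_sum_policy _ hb) (bdd_sum_policy _ hb),
      ← mean_sub ((bdd_sum_policy _ (hrw _)).sub (bdd_sum_policy _ (hrw _)))
        ((bdd_sum_policy _ hb).sub (bdd_sum_policy _ hb)), pairMean, expect_eq_mean]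
    congr 1
    funext s
    have e3 : ∀ a, ∑ a', P.πref s a' * P.relDiff r' s a a' =
        (P.rewardOf P.πstar s a - r' s a) -
          ∑ a', (P.πref s a' * P.rewardOf P.πstar s a' - P.πref s a' * r' s a') := fun a => by
      rw [← one_mul (P.rewardOf P.πstar s a - r' s a), ← sum_policy P.πref s, Finset.sum_mul,
        ← Finset.sum_sub_distrib]
      refine Finset.sum_congr rfl fun a' _ => ?_
      rw [relDiff]; ring
    simp only [e3, mul_sub, Finset.sum_sub_distrib, ← Finset.sum_mul, sum_policy]
    ring
  have h4 : P.expect πc r' - P.expect P.πref r' - P.β * P.kl πc -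
      (P.expect π (P.rewardOf P.πstar) - P.expect P.πref (P.rewardOf P.πstar) -
        P.β * P.kl π) ≤ (nll D (P.rewardOf P.πstar) - nll D r') / η := by
    rw [le_div_iff₀ hη]
    simp only [rpoObj] at h3
    linarith
  have j1 : P.J πc = P.expect πc P.rstar - P.β * P.kl πc := rfl
  have j2 : P.J π = P.expect π P.rstar - P.β * P.kl π := rfl
  rw [e2, gap, gap, j1, j2]
  linarith

variable (P) in
/-- The mean squared relative reward error of `r` under `π`. -/
def sqErr (r : S → A → ℝ) (π : Policy S A) : ℝ :=
  P.pairMean π fun s a a' => P.relDiff r s a a' ^ 2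

lemma sqErr_nonneg (r : S → A → ℝ) (π : Policy S A) : 0 ≤ P.sqErr r π :=
  pairMean_nonneg π fun _ _ _ => sq_nonneg _

lemma le_add_mul_sq {l : ℝ} (hl : 0 < l) (x y : ℝ) :
    x * y ≤ l / 2 * x ^ 2 + 1 / (2 * l) * y ^ 2 := by
  have : l / 2 * x ^ 2 + 1 / (2 * l) * y ^ 2 - x * y = (l * x - y) ^ 2 / (2 * l) := by
    field_simp; ring
  have : 0 ≤ (l * x - y) ^ 2 / (2 * l) := by positivity
  linarith

/-- The likelihood deviation bound that holds with high probability on a dataset collected with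
the policies `pol 0, ..., pol (n - 1)`. -/
def LikelihoodBound (P : Problem S A) (Pi : Finset (Policy S A)) (D : Dataset S A)
    (pol : ℕ → Policy S A) (g l : ℝ) : Prop :=
  ∀ r ∈ P.rewardClass Pi, D.length * (nll D (P.rewardOf P.πstar) - nll D r) ≤
    2 * l - g * ∑ i ∈ Finset.range D.length, P.sqErr r (pol i)

/-- The self-transfer policy competes with the uniform mixture of any part of the data. -/
lemma IsRPO.gap_le_average (hPi : P.PolicyClass Pi) {D : Dataset S A} {η g l : ℝ}
    (hη : 0 < η) (hg : 0 < g) {π : Policy S A} {r : S → A → ℝ} (h : P.IsRPO Pi D η π r)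
    {pol : ℕ → Policy S A} (hL : LikelihoodBound P Pi D pol g l) (hD : 0 < D.length)
    {I : Finset ℕ} (hI : I.Nonempty) (hID : I ⊆ Finset.range D.length)
    (hpol : ∀ i ∈ I, pol i ∈ conv Pi) :
    P.gap π ≤ (I.card : ℝ)⁻¹ * ∑ i ∈ I, P.gap (pol i) +
      η * D.length / (4 * g * I.card) + 2 * l / (η * D.length) := by
  obtain ⟨πc, hc, hπc, hgap⟩ := exists_average hPi hI hpol
  obtain ⟨r', hr', hle⟩ := h.gap_le hPi hη hc
  have hm : (0 : ℝ) < I.card := by exact_mod_cast hI.card_pos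
  have hn : (0 : ℝ) < D.length := by exact_mod_cast hD
  -- Chosen so that the squared-error term of AM-GM, `1/(2 lam)` times the average over `I`, has
  -- exactly the coefficient `g/(η n)` of the negative term in the likelihood bound.
  set lam := η * D.length / (2 * g * I.card) with hlam
  have hlam0 : 0 < lam := by positivity
  have h1 : P.pairMean πc (P.relDiff r') ≤ lam / 2 * 1 + 1 / (2 * lam) * P.sqErr r' πc := by
    have e := pairMean_add_mul (P := P) πc (lam / 2) (1 / (2 * lam)) (w := fun _ _ => 1)
      (fun _ => Bdd.const 1) fun a a' => (bdd_relDiff hr' a a').pow 2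
    rw [expect_one] at e
    rw [sqErr, ← e]
    refine pairMean_mono (bdd_relDiff hr') (fun a a' => ((Bdd.const _).mul (Bdd.const 1)).add
      ((Bdd.const _).mul ((bdd_relDiff hr' a a').pow 2))) fun s a a' => ?_
    have := le_add_mul_sq hlam0 1 (P.relDiff r' s a a')
    exact mul_le_mul_of_nonneg_left (by simpa using this) (policy_nonneg _ _ _)
  -- The likelihood bound controls the error summed over the whole dataset, so the sum over `I` is
  -- enlarged to it; the cost is the factor `n/|I|` in the final bound.
  have h2 : P.sqErr r' πc ≤
      (I.card : ℝ)⁻¹ * ∑ i ∈ Finset.range D.length, P.sqErr r' (pol i) := by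
    rw [sqErr, pairMean_average hπc fun a a' => (bdd_relDiff hr' a a').pow 2]
    exact mul_le_mul_of_nonneg_left (Finset.sum_le_sum_of_subset_of_nonneg hID
      fun i _ _ => sqErr_nonneg r' (pol i)) (inv_nonneg.mpr hm.le)
  have h3 := hL r' hr'
  generalize ∑ i ∈ Finset.range D.length, P.sqErr r' (pol i) = qs at h2 h3
  have h4 : (nll D (P.rewardOf P.πstar) - nll D r') / η ≤
      (2 * l - g * qs) / (η * D.length) := by
    rw [div_le_div_iff₀ hη (by positivity)]
    nlinarith
  have h5 := mul_le_mul_of_nonneg_left h2 (by positivity : 0 ≤ 1 / (2 * lam))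
  have e1 : 1 / (2 * lam) * ((I.card : ℝ)⁻¹ * qs) = g * qs / (η * D.length) := by
    rw [hlam]; field_simp
  have e2 : lam / 2 * 1 = η * D.length / (4 * g * I.card) := by
    rw [hlam]; field_simp; ring
  rw [sub_div (2 * l)] at h4
  linarith

/-- The self-transfer policy competes with `π*`, at a price controlled by the average gap of the
data. -/
lemma IsRPO.gap_le_coverage (hPi : P.PolicyClass Pi) {D : Dataset S A} {η g l : ℝ}
    (hη : 0 < η) (hg : 0 < g) {π : Policy S A} {r : S → A → ℝ} (h : P.IsRPO Pi D η π r)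
    {pol : ℕ → Policy S A} (hL : LikelihoodBound P Pi D pol g l) (hD : 0 < D.length)
    (hpol : ∀ i ∈ Finset.range D.length, pol i ∈ conv Pi) :
    P.gap π ≤ η / (4 * g) * (1 + kappa (Real.exp (2 * P.R / P.β)) / P.β *
      ((∑ i ∈ Finset.range D.length, P.gap (pol i)) / D.length)) +
      2 * l / (η * D.length) := by
  have hs := band_πstar hPi
  obtain ⟨r', hr', hle⟩ := h.gap_le hPi hη (mem_conv_of_mem hPi.realizable)
  have hn : (0 : ℝ) < D.length := by exact_mod_cast hD
  set κ := kappa (Real.exp (2 * P.R / P.β))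
  -- Same cancellation as for the mixture, now with all `n` samples averaged.
  set lam := η / (2 * g) with hlam
  have hlam0 : 0 < lam := by positivity
  -- Change of measure from `π*` to `pol i`: AM-GM separates the density ratio from the error, and
  -- the second moment of the ratio is bounded by the gap of `pol i`.
  have h1 : ∀ i ∈ Finset.range D.length, P.pairMean P.πstar (P.relDiff r') ≤
      lam / 2 * (1 + κ / P.β * P.gap (pol i)) + 1 / (2 * lam) * P.sqErr r' (pol i) := by
    intro i hi
    have hb := band_of_mem_conv hPi (hpol i hi)
    refine le_trans ?_ (add_le_add_left (mul_le_mul_of_nonneg_left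
      (expect_sq_ratio_le hPi (hpol i hi)) (by positivity : 0 ≤ lam / 2)) _)
    rw [sqErr, ← pairMean_add_mul (pol i) _ _ (fun a => (hb.bdd_div hs a).pow 2)
      fun a a' => (bdd_relDiff hr' a a').pow 2]
    refine pairMean_mono (bdd_relDiff hr') (fun a a' =>
      ((Bdd.const _).mul ((hb.bdd_div hs a).pow 2)).add
      ((Bdd.const _).mul ((bdd_relDiff hr' a a').pow 2))) fun s a a' => ?_
    have := mul_le_mul_of_nonneg_left
      (le_add_mul_sq hlam0 (P.πstar s a / pol i s a) (P.relDiff r' s a a')) (hb.pos s a).le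
    refine le_trans (le_of_eq ?_) this
    have := (hb.pos s a).ne'
    field_simp
  have h2 := Finset.sum_le_sum h1
  rw [Finset.sum_const, Finset.card_range, nsmul_eq_mul, Finset.sum_add_distrib,
    ← Finset.mul_sum, ← Finset.mul_sum, Finset.sum_add_distrib, Finset.sum_const,
    Finset.card_range, nsmul_eq_mul, ← Finset.mul_sum] at h2
  have h3 := hL r' hr'
  generalize ∑ i ∈ Finset.range D.length, P.sqErr r' (pol i) = qs at h2 h3
  generalize ∑ i ∈ Finset.range D.length, P.gap (pol i) = G at h2 ⊢
  have h4 : (nll D (P.rewardOf P.πstar) - nll D r') / η ≤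
      (2 * l - g * qs) / (η * D.length) := by
    rw [div_le_div_iff₀ hη (by positivity)]
    nlinarith
  have h5 : P.pairMean P.πstar (P.relDiff r') ≤
      η / (4 * g) * (1 + κ / P.β * (G / D.length)) + g * qs / (η * D.length) := by
    rw [← mul_le_mul_iff_right₀ hn]
    refine h2.trans (le_of_eq ?_)
    have := P.β_pos.ne'
    rw [hlam]
    field_simp
    ring
  have h0 : P.gap P.πstar = 0 := sub_self _
  rw [sub_div (2 * l)] at h4
  linarith

end Problem

/-! ### Expectations under discrete laws -/

section Pexp

open scoped ENNReal

variable {X Y : Type*}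

/-- The expectation of a nonnegative function under a discrete law. -/
def pexp (p : PMF X) (f : X → ℝ≥0∞) : ℝ≥0∞ := ∑' x, p x * f x

lemma pexp_bind (p : PMF X) (q : X → PMF Y) (f : Y → ℝ≥0∞) :
    pexp (p.bind q) f = pexp p fun x => pexp (q x) f := by
  simp only [pexp, PMF.bind_apply, ← ENNReal.tsum_mul_right, ← ENNReal.tsum_mul_left]
  rw [ENNReal.tsum_comm]
  simp only [mul_assoc]

lemma pexp_pure (a : X) (f : X → ℝ≥0∞) : pexp (PMF.pure a) f = f a := by
  rw [pexp, tsum_eq_single a fun b hb => by rw [PMF.pure_apply_of_ne _ _ hb, zero_mul],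
    PMF.pure_apply_self, one_mul]

lemma pexp_map (p : PMF X) (g : X → Y) (f : Y → ℝ≥0∞) :
    pexp (p.map g) f = pexp p fun x => f (g x) := by
  rw [PMF.map, pexp_bind]
  simp only [Function.comp, pexp_pure]

lemma pexp_const (p : PMF X) (c : ℝ≥0∞) : pexp p (fun _ => c) = c := by
  rw [pexp, ENNReal.tsum_mul_right, p.tsum_coe, one_mul]

lemma pexp_mono {p : PMF X} {f g : X → ℝ≥0∞} (h : ∀ x ∈ p.support, f x ≤ g x) :
    pexp p f ≤ pexp p g := by
  refine ENNReal.tsum_le_tsum fun x => ?_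
  by_cases hx : p x = 0
  · rw [hx, zero_mul, zero_mul]
  · exact mul_le_mul_right (h x hx) _

lemma pexp_mul_left (p : PMF X) (c : ℝ≥0∞) (f : X → ℝ≥0∞) :
    pexp p (fun x => c * f x) = c * pexp p f := by
  simp only [pexp, mul_left_comm _ c, ENNReal.tsum_mul_left]

lemma toOuterMeasure_le_mul_pexp (p : PMF X) {f : X → ℝ≥0∞} {c : ℝ≥0∞} {s : Set X}
    (h : ∀ x ∈ s, 1 ≤ c * f x) : p.toOuterMeasure s ≤ c * pexp p f := by
  rw [PMF.toOuterMeasure_apply, ← pexp_mul_left]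
  refine ENNReal.tsum_le_tsum fun x => ?_
  by_cases hx : x ∈ s
  · rw [Set.indicator_of_mem hx]
    exact le_mul_of_one_le_right zero_le (h x hx)
  · rw [Set.indicator_of_notMem hx]
    exact zero_le

/-- Needed because the length of a dataset, which decides whether an iteration is online, is known
only on the support of the run. -/
lemma bind_congr_support {p : PMF X} {q q' : X → PMF Y} (h : ∀ x ∈ p.support, q x = q' x) :
    p.bind q = p.bind q' := by
  ext y
  simp only [PMF.bind_apply]
  refine tsum_congr fun x => ?_
  by_cases hx : p x = 0
  · rw [hx, zero_mul, zero_mul]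
  · rw [h x hx]

/-- A union bound for lower bounds on probabilities. -/
lemma ofReal_le_toOuterMeasure_of_subset (p : PMF X) {s u v : Set X} {δ : ℝ} (hδ : 0 ≤ δ)
    (hu : ENNReal.ofReal (1 - δ) ≤ p.toOuterMeasure u)
    (hv : p.toOuterMeasure vᶜ ≤ ENNReal.ofReal δ) (h : ∀ x ∈ p.support, x ∈ u → x ∈ v → x ∈ s) :
    ENNReal.ofReal (1 - 2 * δ) ≤ p.toOuterMeasure s := by
  have h1 : p.toOuterMeasure u ≤ p.toOuterMeasure s + ENNReal.ofReal δ := by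
    calc p.toOuterMeasure u ≤ p.toOuterMeasure (s ∪ vᶜ) :=
          PMF.toOuterMeasure_mono _ fun x hx => by
            by_cases hxv : x ∈ v
            · exact Or.inl (h x hx.2 hx.1 hxv)
            · exact Or.inr hxv
      _ ≤ _ := (MeasureTheory.measure_union_le _ _).trans (add_le_add_right hv _)
  rw [show 1 - 2 * δ = (1 - δ) - δ by ring, ENNReal.ofReal_sub _ hδ]
  exact tsub_le_iff_right.mpr (hu.trans h1)

lemma pexp_toPMF {A : Type*} [Fintype A] (q : stdSimplex ℝ A) (f : A → ℝ≥0∞) :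
    pexp (toPMF q) f = ∑ a, ENNReal.ofReal (q a) * f a := tsum_fintype _

lemma pexp_labelPMF (x : ℝ) (f : Bool → ℝ≥0∞) :
    pexp (labelPMF x) f = ENNReal.ofReal (Real.sigmoid x) * f true +
      ENNReal.ofReal (1 - Real.sigmoid x) * f false := by
  rw [pexp, tsum_fintype, Fintype.sum_bool]
  simp [labelPMF]

lemma pexp_toPMF_ofReal {A : Type*} [Fintype A] (q : stdSimplex ℝ A) {f : A → ℝ}
    (h : ∀ a, 0 ≤ f a) :
    pexp (toPMF q) (fun a => ENNReal.ofReal (f a)) = ENNReal.ofReal (∑ a, q a * f a) := by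
  have h0 : ∀ a, 0 ≤ q a := q.2.1
  rw [pexp_toPMF, ENNReal.ofReal_sum_of_nonneg fun a _ => mul_nonneg (h0 a) (h a)]
  exact Finset.sum_congr rfl fun a _ => (ENNReal.ofReal_mul (h0 a)).symm

end Pexp

variable {S A : Type*} [Fintype A]

/-! ### The likelihood ratio supermartingale -/

/-- The log-likelihood of the label of one sample. -/
def logLik (r : S → A → ℝ) (x : Step S A) : ℝ :=
  if x.label then Real.log (Real.sigmoid (r x.state x.act - r x.state x.act'))
  else Real.log (Real.sigmoid (r x.state x.act' - r x.state x.act))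

/-- Identifies the mean square root of a likelihood ratio with a Bhattacharyya coefficient, one
label value at a time. -/
lemma mul_exp_half_log_sub {p q : ℝ} (hp : 0 < p) (hq : 0 < q) :
    p * Real.exp (1 / 2 * (Real.log q - Real.log p)) = √p * √q := by
  have e : 1 / 2 * (Real.log q - Real.log p) = Real.log (√q / √p) := by
    rw [Real.log_div (Real.sqrt_pos.mpr hq).ne' (Real.sqrt_pos.mpr hp).ne',
      Real.log_sqrt hq.le, Real.log_sqrt hp.le]
    ring
  rw [e, Real.exp_log (div_pos (Real.sqrt_pos.mpr hq) (Real.sqrt_pos.mpr hp))]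
  nth_rw 1 [← Real.mul_self_sqrt hp.le]
  have := (Real.sqrt_pos.mpr hp).ne'
  field_simp

namespace Problem

variable {P : Problem S A} {Pi : Finset (Policy S A)}

variable (P) in
/-- The constant `(1 + e^R)^{-2}`, a lower bound for the slope of the sigmoid on `[-R, R]`. -/
def slope : ℝ := ((1 + Real.exp P.R) ^ 2)⁻¹

lemma slope_pos : 0 < P.slope := by unfold slope; positivity

variable (P) in
/-- The increment of the log of the likelihood ratio supermartingale. -/
def stepWeight (r : S → A → ℝ) (x : Step S A) : ℝ :=
  1 / 2 * (logLik r x - logLik (P.rewardOf P.πstar) x) + P.slope ^ 2 / 4 * P.sqErr r x.policy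

/-- The true label law is that of the realizable reward, so the mean of the root likelihood ratio is
a Bhattacharyya coefficient. It falls below 1 by a quarter of the squared difference of the
sigmoids, hence by a multiple of the squared relative error. The nonnegativity clause lets
`ENNReal.ofReal` pass through the averages. -/
lemma pexp_label_le {r : S → A → ℝ} (hr : r ∈ P.rewardClass Pi) (π : Policy S A) (s : S)
    (a a' : A) :
    0 ≤ 1 - P.slope ^ 2 / 4 * P.relDiff r s a a' ^ 2 ∧
    pexp (labelPMF (P.rstar s a - P.rstar s a')) (fun y => ENNReal.ofReal (Real.exp
      (1 / 2 * (logLik r ⟨s, a, a', y, π⟩ - logLik (P.rewardOf P.πstar) ⟨s, a, a', y, π⟩)))) ≤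
      ENNReal.ofReal (1 - P.slope ^ 2 / 4 * P.relDiff r s a a' ^ 2) := by
  obtain ⟨μ, hμ⟩ := exists_rewardOf_πstar_eq P
  have e : P.rstar s a - P.rstar s a' =
      P.rewardOf P.πstar s a - P.rewardOf P.πstar s a' := by rw [hμ, hμ]; ring
  have hb : ∀ r ∈ P.rewardClass Pi, |r s a - r s a'| ≤ P.R := by
    rintro _ ⟨π', -, rfl⟩
    have h1 := rewardOf_mem (P := P) π' s a
    have h2 := rewardOf_mem (P := P) π' s a'
    rw [abs_le]
    constructor <;> linarith [h1.1, h1.2, h2.1, h2.2]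
  have hb0 : |P.rewardOf P.πstar s a - P.rewardOf P.πstar s a'| ≤ P.R := by
    have h1 := rewardOf_mem (P := P) P.πstar s a
    have h2 := rewardOf_mem (P := P) P.πstar s a'
    rw [abs_le]
    constructor <;> linarith [h1.1, h1.2, h2.1, h2.2]
  have hsl := mul_sub_sq_le_sigmoid_sub_sq hb0 (hb r hr)
  have hbc := bhattacharyya_le
    (p := Real.sigmoid (P.rewardOf P.πstar s a - P.rewardOf P.πstar s a'))
    (q := Real.sigmoid (r s a - r s a'))
    ⟨Real.sigmoid_nonneg _, Real.sigmoid_le_one _⟩ ⟨Real.sigmoid_nonneg _, Real.sigmoid_le_one _⟩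
  have hle : √(Real.sigmoid (P.rewardOf P.πstar s a - P.rewardOf P.πstar s a')) *
      √(Real.sigmoid (r s a - r s a')) +
      √(1 - Real.sigmoid (P.rewardOf P.πstar s a - P.rewardOf P.πstar s a')) *
      √(1 - Real.sigmoid (r s a - r s a')) ≤
      1 - P.slope ^ 2 / 4 * P.relDiff r s a a' ^ 2 := by
    refine hbc.trans ?_
    rw [relDiff, slope]
    linarith
  refine ⟨le_trans (by positivity) hle, ?_⟩
  rw [e, pexp_labelPMF, ← ENNReal.ofReal_mul (Real.sigmoid_nonneg _),
    ← ENNReal.ofReal_mul (sub_nonneg.mpr (Real.sigmoid_le_one _)),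
    ← ENNReal.ofReal_add (mul_nonneg (Real.sigmoid_nonneg _) (Real.exp_pos _).le)
      (mul_nonneg (sub_nonneg.mpr (Real.sigmoid_le_one _)) (Real.exp_pos _).le)]
  refine ENNReal.ofReal_le_ofReal (le_trans (le_of_eq ?_) hle)
  simp only [logLik, if_true, Bool.false_eq_true, if_false]
  rw [mul_exp_half_log_sub (Real.sigmoid_pos _) (Real.sigmoid_pos _),
    ← Real.sigmoid_neg, ← Real.sigmoid_neg, neg_sub, neg_sub,
    mul_exp_half_log_sub (Real.sigmoid_pos _) (Real.sigmoid_pos _)]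

lemma pexp_sample (π : Policy S A) (f : Step S A → ENNReal) :
    pexp (P.sample π) f = pexp P.ρ fun s => pexp (toPMF (π s)) fun a =>
      pexp (toPMF (P.πref s)) fun a' =>
        pexp (labelPMF (P.rstar s a - P.rstar s a')) fun y => f ⟨s, a, a', y, π⟩ := by
  simp only [sample, pexp_bind, pexp_map]

/-- The compensator `k * sqErr` depends only on the policy and leaves the expectation as a factor;
then `e^u (1 - u) ≤ 1`. -/
lemma pexp_sample_stepWeight_le {r : S → A → ℝ} (hr : r ∈ P.rewardClass Pi) (π : Policy S A) :
    pexp (P.sample π) (fun x => ENNReal.ofReal (Real.exp (P.stepWeight r x))) ≤ 1 := by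
  set k := P.slope ^ 2 / 4 with hk
  have h0 := fun s a a' => (pexp_label_le hr π s a a').1
  have hbdd : ∀ a a', Bdd fun s => 1 - k * P.relDiff r s a a' ^ 2 := fun a a' =>
    (Bdd.const 1).sub ((Bdd.const k).mul ((bdd_relDiff hr a a').pow 2))
  have h1 : pexp (P.sample π) (fun x => ENNReal.ofReal (Real.exp
      (1 / 2 * (logLik r x - logLik (P.rewardOf P.πstar) x)))) ≤
      ENNReal.ofReal (1 - k * P.sqErr r π) := by
    rw [pexp_sample]
    calc _ ≤ pexp P.ρ (fun s => pexp (toPMF (π s)) fun a => pexp (toPMF (P.πref s)) fun a' =>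
          ENNReal.ofReal (1 - k * P.relDiff r s a a' ^ 2)) :=
        pexp_mono fun s _ => pexp_mono fun a _ => pexp_mono fun a' _ =>
          (pexp_label_le hr π s a a').2
      _ = pexp P.ρ (fun s => ENNReal.ofReal (∑ a, π s a * ∑ a', P.πref s a' *
          (1 - k * P.relDiff r s a a' ^ 2))) := by
        congr 1
        funext s
        rw [← pexp_toPMF_ofReal (π s) fun a => Finset.sum_nonneg fun a' _ =>
          mul_nonneg (P.πref_pos s a').le (h0 s a a')]
        congr 1
        funext a
        rw [pexp_toPMF_ofReal (P.πref s) (h0 s a)]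
      _ = ENNReal.ofReal (P.pairMean π fun s a a' => 1 - k * P.relDiff r s a a' ^ 2) :=
        tsum_ρ_mul_ofReal
          (bdd_sum_policy π fun a => bdd_sum_policy P.πref fun a' => hbdd a a')
          fun s => Finset.sum_nonneg fun a _ => mul_nonneg (policy_nonneg π s a)
            (Finset.sum_nonneg fun a' _ => mul_nonneg (P.πref_pos s a').le (h0 s a a'))
      _ = _ := by
        have e := pairMean_add_mul (P := P) π 1 (-k) (w := fun _ _ => 1) (fun _ => Bdd.const 1)
          fun a a' => (bdd_relDiff hr a a').pow 2
        rw [expect_one] at e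
        rw [sqErr, show 1 - k * P.pairMean π (fun s a a' => P.relDiff r s a a' ^ 2) =
          1 * 1 + -k * P.pairMean π (fun s a a' => P.relDiff r s a a' ^ 2) by ring, ← e]
        congr 2
        funext s a a'
        ring
  have h2 : pexp (P.sample π) (fun x => ENNReal.ofReal (Real.exp (P.stepWeight r x))) =
      ENNReal.ofReal (Real.exp (k * P.sqErr r π)) * pexp (P.sample π) (fun x =>
        ENNReal.ofReal (Real.exp (1 / 2 * (logLik r x - logLik (P.rewardOf P.πstar) x)))) := by
    rw [← pexp_mul_left]
    simp only [pexp_sample, ← ENNReal.ofReal_mul (Real.exp_pos _).le, ← Real.exp_add, stepWeight]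
    simp only [add_comm]
    rfl
  rw [h2]
  refine (mul_le_mul_right h1 _).trans ?_
  rw [← ENNReal.ofReal_mul (Real.exp_pos _).le, ENNReal.ofReal_le_one]
  calc Real.exp (k * P.sqErr r π) * (1 - k * P.sqErr r π)
      ≤ Real.exp (k * P.sqErr r π) * Real.exp (-(k * P.sqErr r π)) := by
        refine mul_le_mul_of_nonneg_left ?_ (Real.exp_pos _).le
        linarith [Real.add_one_le_exp (-(k * P.sqErr r π))]
    _ = 1 := by rw [← Real.exp_add, add_neg_cancel, Real.exp_zero]

/-! ### Runs of an algorithm -/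

lemma policy_eq_of_mem_support_sample {π : Policy S A} {x : Step S A}
    (h : x ∈ (P.sample π).support) : x.policy = π := by
  simp only [sample, PMF.mem_support_bind_iff, PMF.mem_support_map_iff] at h
  obtain ⟨s, -, a, -, a', -, y, -, rfl⟩ := h
  rfl

/-- Each sample records the policy that `next` drew, so invariants of a run can be stated on the
data alone. -/
lemma runLaw_support_induction {next : Dataset S A → PMF (Policy S A)}
    {motive : Dataset S A → Prop} (nil : motive [])
    (step : ∀ D x, motive D → x.policy ∈ (next D).support → motive (D ++ [x])) (n : ℕ) :
    ∀ D ∈ (P.runLaw next n).support, motive D := by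
  induction n with
  | zero =>
    intro D hD
    rw [runLaw, PMF.mem_support_pure_iff] at hD
    rwa [hD]
  | succ n ih =>
    intro D hD
    simp only [runLaw, PMF.mem_support_bind_iff, PMF.mem_support_map_iff] at hD
    obtain ⟨D, hD, π, hπ, x, hx, rfl⟩ := hD
    exact step D x (ih D hD) (by rwa [policy_eq_of_mem_support_sample hx])

lemma length_of_mem_support_runLaw {next : Dataset S A → PMF (Policy S A)} {n : ℕ} :
    ∀ D ∈ (P.runLaw next n).support, D.length = n := by
  induction n with
  | zero =>
    intro D hD
    rw [runLaw, PMF.mem_support_pure_iff] at hD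
    rw [hD, List.length_nil]
  | succ n ih =>
    intro D hD
    simp only [runLaw, PMF.mem_support_bind_iff, PMF.mem_support_map_iff] at hD
    obtain ⟨D, hD, π, hπ, x, hx, rfl⟩ := hD
    rw [List.length_append, ih D hD, List.length_singleton]

lemma pexp_runLaw_succ (next : Dataset S A → PMF (Policy S A)) (n : ℕ)
    (f : Dataset S A → ENNReal) :
    pexp (P.runLaw next (n + 1)) f = pexp (P.runLaw next n) fun D => pexp (next D) fun π =>
      pexp (P.sample π) fun x => f (D ++ [x]) := by
  simp only [runLaw, pexp_bind, pexp_map]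

/-- Supermartingale property: conditionally on the past and on the chosen policy, each new factor
has mean at most 1, however `next` adapts or randomizes. -/
lemma pexp_runLaw_stepWeight_le {r : S → A → ℝ} (hr : r ∈ P.rewardClass Pi)
    (next : Dataset S A → PMF (Policy S A)) (n : ℕ) :
    pexp (P.runLaw next n) (fun D =>
      ENNReal.ofReal (Real.exp (D.map (P.stepWeight r)).sum)) ≤ 1 := by
  induction n with
  | zero => simp [runLaw, pexp_pure]
  | succ n ih =>
    rw [pexp_runLaw_succ]
    refine le_trans (pexp_mono fun D _ => ?_) ih
    rw [← pexp_const (next D) (ENNReal.ofReal (Real.exp (D.map (P.stepWeight r)).sum))]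
    refine pexp_mono fun π _ => ?_
    simp only [List.map_append, List.map_singleton, List.sum_append, List.sum_singleton,
      Real.exp_add, ENNReal.ofReal_mul (Real.exp_pos _).le]
    rw [pexp_mul_left]
    exact mul_le_of_le_one_right zero_le (pexp_sample_stepWeight_le hr π)

lemma pexp_runLaw_take (next : Dataset S A → PMF (Policy S A)) (f : Dataset S A → ENNReal)
    {n T : ℕ} (h : n ≤ T) :
    pexp (P.runLaw next T) (fun D => f (D.take n)) ≤ pexp (P.runLaw next n) f := by
  induction T, h using Nat.le_induction with
  | base =>
    refine pexp_mono fun D hD => ?_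
    rw [List.take_of_length_le (length_of_mem_support_runLaw D hD).le]
  | succ T hT ih =>
    rw [pexp_runLaw_succ]
    refine le_trans (pexp_mono fun D hD => ?_) ih
    have hl := length_of_mem_support_runLaw D hD
    simp only [List.take_append_of_le_length (hl.symm ▸ hT : n ≤ D.length), pexp_const, le_refl]

/-- With high probability, the likelihood ratios of all rewards of the class stay small. -/
lemma toOuterMeasure_stepWeight_le (hPi : P.PolicyClass Pi)
    (next : Dataset S A → PMF (Policy S A)) {T : ℕ} (hT : 0 < T) {δ : ℝ} (hδ : 0 < δ) :
    (P.runLaw next T).toOuterMeasure {D | ∀ n, n ≤ T → 1 ≤ n → ∀ r ∈ P.rewardClass Pi,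
      ((D.take n).map (P.stepWeight r)).sum ≤ Real.log (Pi.card * T / δ)}ᶜ ≤
      ENNReal.ofReal δ := by
  have hc : (0 : ℝ) < Pi.card := by
    exact_mod_cast Finset.card_pos.mpr ⟨_, hPi.realizable⟩
  have hT' : (0 : ℝ) < T := by exact_mod_cast hT
  set l := Real.log (Pi.card * T / δ) with hl
  -- Markov's inequality costs `e^{-l}` for each prefix length and each policy; `l` makes these `T
  -- |Π|` failure probabilities add up to `δ`.
  have hE : Real.exp (-l) = δ / (Pi.card * T) := by
    rw [hl, Real.exp_neg, Real.exp_log (by positivity), inv_div]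
  have hsub : {D : Dataset S A | ∀ n, n ≤ T → 1 ≤ n → ∀ r ∈ P.rewardClass Pi,
      ((D.take n).map (P.stepWeight r)).sum ≤ l}ᶜ ⊆
      ⋃ i ∈ Finset.Icc 1 T ×ˢ Pi,
        {D | l ≤ ((D.take i.1).map (P.stepWeight (P.rewardOf i.2))).sum} := by
    intro D hD
    simp only [Set.mem_compl_iff, Set.mem_ofPred_eq, not_forall, not_le] at hD
    obtain ⟨n, hn, hn1, r, ⟨π, hπ, rfl⟩, h⟩ := hD
    refine Set.mem_biUnion (x := (n, π)) ?_ h.le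
    simp [hn, hn1, hπ]
  refine (MeasureTheory.measure_mono hsub).trans
    ((MeasureTheory.measure_biUnion_finset_le _ _).trans ?_)
  have hone : ∀ i ∈ Finset.Icc 1 T ×ˢ Pi, (P.runLaw next T).toOuterMeasure
      {D | l ≤ ((D.take i.1).map (P.stepWeight (P.rewardOf i.2))).sum} ≤
      ENNReal.ofReal (Real.exp (-l)) := by
    intro i hi
    rw [Finset.mem_product, Finset.mem_Icc] at hi
    have hr : P.rewardOf i.2 ∈ P.rewardClass Pi := ⟨_, hi.2, rfl⟩
    refine (toOuterMeasure_le_mul_pexp _ (c := ENNReal.ofReal (Real.exp (-l)))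
      (f := fun D => ENNReal.ofReal (Real.exp
        ((D.take i.1).map (P.stepWeight (P.rewardOf i.2))).sum)) fun D hD => ?_).trans ?_
    · rw [← ENNReal.ofReal_mul (Real.exp_pos _).le, ← Real.exp_add, ENNReal.one_le_ofReal,
        Real.one_le_exp_iff]
      have : l ≤ _ := hD
      linarith
    · exact mul_le_of_le_one_right zero_le ((pexp_runLaw_take next
        (fun D => ENNReal.ofReal (Real.exp (D.map (P.stepWeight (P.rewardOf i.2))).sum))
        hi.1.2).trans (pexp_runLaw_stepWeight_le hr next i.1))
  refine (Finset.sum_le_sum hone).trans (le_of_eq ?_)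
  rw [Finset.sum_const, Finset.card_product, Nat.card_Icc, nsmul_eq_mul,
    ← ENNReal.ofReal_natCast, ← ENNReal.ofReal_mul (Nat.cast_nonneg _), hE]
  congr 1
  push_cast [Nat.add_sub_cancel]
  field_simp

lemma sum_map_range (f : ℕ → ℝ) (n : ℕ) :
    ((List.range n).map f).sum = ∑ i ∈ Finset.range n, f i := by
  induction n with
  | zero => simp
  | succ n ih => simp [List.range_succ, Finset.sum_range_succ, ih]

lemma length_mul_nll_sub (D : Dataset S A) (hD : 0 < D.length) (r r' : S → A → ℝ) :
    D.length * (nll D r - nll D r') = (D.map fun x => logLik r' x - logLik r x).sum := by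
  have e : ∀ r : S → A → ℝ, (D.map fun x =>
      if x.label then -Real.log (Real.sigmoid (r x.state x.act - r x.state x.act'))
      else -Real.log (Real.sigmoid (r x.state x.act' - r x.state x.act))).sum =
      -(D.map (logLik r)).sum := fun r => by
    clear hD
    induction D with
    | nil => simp
    | cons x D ih =>
      rw [List.map_cons, List.sum_cons, ih, List.map_cons, List.sum_cons, neg_add, logLik]
      split_ifs <;> rfl
  have hn : (D.length : ℝ) ≠ 0 := by exact_mod_cast hD.ne'
  have e' : (D.map fun x => logLik r' x - logLik r x).sum =
      (D.map (logLik r')).sum - (D.map (logLik r)).sum := by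
    clear hD hn e
    induction D with
    | nil => simp
    | cons x D ih => simp only [List.map_cons, List.sum_cons, ih]; ring
  rw [nll, nll, e, e, e']
  field_simp
  ring

/-- Doubling the bound on the half log-likelihood ratios produces `2l` and turns `slope²/4` into
`slope²/2`. -/
lemma likelihoodBound_of_stepWeight_le {x : ℕ → Step S A} {n : ℕ} (hn : 0 < n) {l : ℝ}
    (h : ∀ r ∈ P.rewardClass Pi, (((List.range n).map x).map (P.stepWeight r)).sum ≤ l) :
    LikelihoodBound P Pi ((List.range n).map x) (fun i => (x i).policy) (P.slope ^ 2 / 2) l := by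
  intro r hr
  have h1 := h r hr
  rw [length_mul_nll_sub _ (by simpa using hn)]
  simp only [List.length_map, List.length_range, List.map_map, sum_map_range, Function.comp_def,
    stepWeight, Finset.sum_add_distrib, ← Finset.mul_sum] at h1 ⊢
  linarith

end Problem

/-! ### The online part of a run -/

lemma onlineData_append (N : ℕ) (α : ℝ) (D : Dataset S A) (x : Step S A) :
    onlineData N α (D ++ [x]) =
      if IsOnline N α D.length then onlineData N α D ++ [x] else onlineData N α D := by
  unfold onlineData
  rw [List.zipIdx_append, List.filter_append, List.map_append]
  by_cases h : IsOnline N α D.length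
  · simp [h]
  · simp [h]

lemma transferData_append (N : ℕ) (α : ℝ) (D : Dataset S A) (x : Step S A) :
    transferData N α (D ++ [x]) =
      if IsOnline N α D.length then transferData N α D else transferData N α D ++ [x] := by
  unfold transferData
  rw [List.zipIdx_append, List.filter_append, List.map_append]
  by_cases h : IsOnline N α D.length
  · simp [h]
  · simp [h]

/-- The number of online iterations among the first `n` iterations. -/
def onlineCount (N : ℕ) (α : ℝ) (n : ℕ) : ℕ := {i ∈ Finset.range n | IsOnline N α i}.card

lemma onlineCount_succ (N : ℕ) (α : ℝ) (n : ℕ) :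
    onlineCount N α (n + 1) = onlineCount N α n + if IsOnline N α n then 1 else 0 := by
  unfold onlineCount
  rw [Finset.range_add_one, Finset.filter_insert]
  split_ifs with h
  · rw [Finset.card_insert_of_notMem (by simp)]
  · rfl

/-- The data collected by the online algorithm inside `tpo` has the law of a run on its own. -/
lemma map_onlineData_runLaw (P : Problem S A) (N : ℕ) (α : ℝ)
    (alg : Dataset S A → PMF (Policy S A)) (tps : Dataset S A → Policy S A) (n : ℕ) :
    (P.runLaw (tpo N α alg tps) n).map (onlineData N α) =
      P.runLaw alg (onlineCount N α n) := by
  induction n with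
  | zero => simp [Problem.runLaw, PMF.pure_map, onlineData, onlineCount]
  | succ n ih =>
    rw [onlineCount_succ]
    rw [Problem.runLaw, PMF.map_bind]
    simp only [PMF.map_bind, PMF.map_comp]
    by_cases h : IsOnline N α n
    · rw [if_pos h, Problem.runLaw, ← ih, PMF.bind_map]
      refine bind_congr_support fun D hD => ?_
      have hl := Problem.length_of_mem_support_runLaw D hD
      simp only [tpo, hl, if_pos h, Function.comp_def, onlineData_append]
    · rw [if_neg h, add_zero, ← ih, PMF.map]
      refine bind_congr_support fun D hD => ?_
      have hl := Problem.length_of_mem_support_runLaw D hD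
      simp only [Function.comp_def, onlineData_append, hl, if_neg h]
      -- A transfer iteration leaves the online data unchanged, so its randomness integrates out.
      change ((tpo N α alg tps D).bind fun π =>
        (P.sample π).map (Function.const _ (onlineData N α D))) = _
      simp only [PMF.map_const, PMF.bind_const]

/-! ### Counting online iterations -/

section Counting

variable {N : ℕ} {α : ℝ}

lemma isOnline_iff (hα : 0 ≤ α) (i : ℕ) : IsOnline N α i ↔ i % N < ⌊α * N⌋₊ := by
  rw [IsOnline, ← Nat.succ_le_iff, Nat.le_floor_iff (by positivity)]
  push_cast
  rfl

lemma floor_mul_le (hα : α ≤ 1) : ⌊α * N⌋₊ ≤ N :=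
  Nat.floor_le_of_le (mul_le_of_le_one_left (Nat.cast_nonneg N) hα)

lemma onlineCount_mul_add (hα : 0 ≤ α) (hα1 : α ≤ 1) (q r : ℕ) (hr : r ≤ N) :
    onlineCount N α (q * N + r) = q * ⌊α * N⌋₊ + min r ⌊α * N⌋₊ := by
  have inner : ∀ q, onlineCount N α (q * N) = q * ⌊α * N⌋₊ → ∀ r, r ≤ N →
      onlineCount N α (q * N + r) = q * ⌊α * N⌋₊ + min r ⌊α * N⌋₊ := by
    intro q hq r
    induction r with
    | zero => simp [hq]
    | succ r ih =>
      intro hr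
      rw [← add_assoc, onlineCount_succ, ih (by omega)]
      have hmod : (q * N + r) % N = r := by
        rw [mul_comm, Nat.mul_add_mod, Nat.mod_eq_of_lt (Nat.lt_of_succ_le hr)]
      rw [isOnline_iff hα, hmod]
      by_cases h : r < ⌊α * N⌋₊
      · rw [if_pos h, min_eq_left h.le, min_eq_left (Nat.succ_le_of_lt h), add_assoc]
      · rw [if_neg h, min_eq_right (not_lt.mp h), min_eq_right (by omega), add_zero]
  refine inner q ?_ r hr
  induction q with
  | zero => simp [onlineCount]
  | succ q ih =>
    rw [add_mul, one_mul, inner q ih N le_rfl, min_eq_right (floor_mul_le hα1)]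
    ring

lemma onlineCount_mul (hα : 0 ≤ α) (hα1 : α ≤ 1) (K : ℕ) :
    onlineCount N α (K * N) = K * ⌊α * N⌋₊ := by
  simpa using onlineCount_mul_add hα hα1 K 0 (Nat.zero_le N)

lemma onlineCount_mono {t u : ℕ} (h : t ≤ u) : onlineCount N α t ≤ onlineCount N α u :=
  Finset.card_le_card (Finset.filter_subset_filter _ (Finset.range_subset_range.mpr h))

lemma onlineCount_le (t : ℕ) : onlineCount N α t ≤ t :=
  (Finset.card_filter_le _ _).trans (Finset.card_range t).le

/-- The half pays for rounding down: `⌊αN⌋ ≥ αN/2` because `αN ≥ 1`. Online iterations come first in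
each block, so unfinished blocks do no harm. -/
lemma half_mul_le_onlineCount (hα : 0 ≤ α) (hα1 : α ≤ 1) (hN : 1 ≤ α * N) (t : ℕ) :
    α * t / 2 ≤ onlineCount N α t := by
  have hN0 : 0 < N := Nat.pos_of_ne_zero fun h => by simp [h] at hN; linarith
  have ht := Nat.div_add_mod' t N
  have hr := (Nat.mod_lt t hN0).le
  rw [← ht, onlineCount_mul_add hα hα1 _ _ hr]
  have hF : α * N / 2 ≤ ⌊α * N⌋₊ := by
    have h1 := Nat.lt_floor_add_one (α * N)
    have h2 : (1 : ℝ) ≤ ⌊α * N⌋₊ := by exact_mod_cast Nat.le_floor (by exact_mod_cast hN)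
    linarith
  have hr' : ((t % N : ℕ) : ℝ) ≤ N := by exact_mod_cast hr
  have h0 : (0 : ℝ) ≤ (t % N : ℕ) := Nat.cast_nonneg _
  have hmin : α * (t % N : ℕ) / 2 ≤ (min (t % N) ⌊α * N⌋₊ : ℕ) := by
    rw [Nat.cast_min]
    refine le_min ?_ ?_
    · nlinarith
    · refine le_trans ?_ hF
      nlinarith
  have hq : (0 : ℝ) ≤ (t / N : ℕ) := Nat.cast_nonneg _
  push_cast at hmin ⊢
  nlinarith

/-- An unfinished block may contain all of its online iterations already; `N ≤ t` provides a
completed block to charge them to, hence the factor 2. -/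
lemma onlineCount_le_two_mul (hα : 0 ≤ α) (hα1 : α ≤ 1) (hN : 1 ≤ α * N) {t : ℕ} (ht : N ≤ t) :
    (onlineCount N α t : ℝ) ≤ 2 * α * t := by
  have hN0 : 0 < N := Nat.pos_of_ne_zero fun h => by simp [h] at hN; linarith
  have hd := Nat.div_add_mod' t N
  have hr := (Nat.mod_lt t hN0).le
  have hq1 : (1 : ℝ) ≤ (t / N : ℕ) := by exact_mod_cast Nat.div_pos ht hN0
  have hcount : onlineCount N α t ≤ (t / N) * ⌊α * N⌋₊ + ⌊α * N⌋₊ := by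
    conv_lhs => rw [← hd, onlineCount_mul_add hα hα1 _ _ hr]
    exact Nat.add_le_add_left (min_le_right _ _) _
  have hF : (⌊α * N⌋₊ : ℝ) ≤ α * N := Nat.floor_le (by positivity)
  have hF0 : (0 : ℝ) ≤ (⌊α * N⌋₊ : ℝ) := Nat.cast_nonneg _
  have htq : ((t / N : ℕ) : ℝ) * N ≤ t := by exact_mod_cast Nat.div_mul_le_self t N
  calc (onlineCount N α t : ℝ) ≤ (t / N : ℕ) * ⌊α * N⌋₊ + ⌊α * N⌋₊ := by exact_mod_cast hcount
    _ ≤ 2 * ((t / N : ℕ) * (α * N)) := by nlinarith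
    _ ≤ 2 * α * t := by nlinarith

end Counting

/-! ### Summing the per-iteration bounds -/

/-- The term `i = 0` is `1/0 = 0`; the others telescope against `2√i`. -/
lemma sum_inv_sqrt_le (t : ℕ) : ∑ i ∈ Finset.range t, 1 / √(i : ℝ) ≤ 2 * √(t : ℝ) := by
  have h : ∀ n : ℕ, ∑ i ∈ Finset.range (n + 1), 1 / √(i : ℝ) ≤ 2 * √(n : ℝ) := by
    intro n
    induction n with
    | zero => simp
    | succ n ih =>
      rw [Finset.sum_range_succ]
      have hp : 0 < √((n + 1 : ℕ) : ℝ) := Real.sqrt_pos.mpr (by positivity)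
      have h1 := Real.sq_sqrt (Nat.cast_nonneg (α := ℝ) n)
      have h2 := Real.sq_sqrt (Nat.cast_nonneg (α := ℝ) (n + 1))
      have h3 : 1 / √((n + 1 : ℕ) : ℝ) ≤ 2 * √((n + 1 : ℕ) : ℝ) - 2 * √(n : ℝ) := by
        rw [div_le_iff₀ hp]
        push_cast at *
        nlinarith [sq_nonneg (√((n : ℝ) + 1) - √(n : ℝ))]
      linarith
  rcases t with _ | n
  · simp
  · refine (h n).trans ?_
    gcongr
    omega

lemma sum_inv_le {t : ℕ} (ht : 1 ≤ t) :
    ∑ i ∈ Finset.range t, 1 / (i : ℝ) ≤ 1 + Real.log t := by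
  obtain ⟨n, rfl⟩ := Nat.exists_eq_add_of_le' ht
  rcases n with _ | n
  · simp
  rw [Finset.sum_range_succ']
  have h := harmonic_le_one_add_log (n + 1)
  have e : (harmonic (n + 1) : ℝ) = ∑ i ∈ Finset.range (n + 1), 1 / ((i + 1 : ℕ) : ℝ) := by
    rw [harmonic]; push_cast; simp only [one_div]
  rw [e] at h
  have : Real.log ((n + 1 : ℕ) : ℝ) ≤ Real.log ((n + 1 + 1 : ℕ) : ℝ) :=
    Real.log_le_log (by positivity) (by push_cast; linarith)
  simp only [Nat.cast_zero, div_zero, add_zero]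
  linarith

/-- The regret of the transfer iterations, from a crude bound on every gap (competing with the
online mixture) and a refined one (in terms of the regret so far). -/
lemma transfer_regret_le {E R α k Cpx b COL L l : ℝ} (hE : 0 < E) (hR : 0 < R) (hα : 0 < α)
    (hα1 : α ≤ 1) (hk : 0 ≤ k) (hCpx : 0 ≤ Cpx) (hb : 0 ≤ b) (hCOL : 0 ≤ COL)
    (hl : 0 ≤ l) {T : ℕ} {g : ℕ → ℝ} {on : ℕ → Prop} {m : ℕ → ℕ}
    (hm : ∀ t, α * t / 2 ≤ m t) (hmt : ∀ t, m t ≤ t) (h0 : on 0)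
    (hon : ∀ t, 1 ≤ t → t ≤ T → ∑ i ∈ Finset.range t with on i, g i ≤
      COL * R * E * √(Cpx * m t * L))
    (hA : ∀ i, i < T → ¬ on i → g i ≤ (m i : ℝ)⁻¹ * ∑ j ∈ Finset.range i with on j, g j +
      b * E * √(l / i) * (i / m i + 1))
    (hB : ∀ i, i < T → ¬ on i → g i ≤ b * E * √(l / i) *
      (2 + k * ((∑ j ∈ Finset.range i, g j) / i)))
    {t : ℕ} (ht : 1 ≤ t) (htT : t ≤ T) (hlog : Real.log t ≤ l) :
    ∑ i ∈ Finset.range t with ¬ on i, g i ≤ b * E * √l * (4 * √(t : ℝ) +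
      3 * (k / α * (E * ((1 + R) * √(1 + Cpx)))) * (2 * COL * √L + 3 * b * √l) * (1 + l)) := by
  set Y := 2 * COL * √L + 3 * b * √l with hY
  set Z := (1 + R) * √(1 + Cpx) with hZ
  have hY0 : 0 ≤ Y := by positivity
  have hs1 : 1 ≤ √(1 + Cpx) := Real.one_le_sqrt.mpr (by linarith)
  have hs2 : √Cpx ≤ √(1 + Cpx) := Real.sqrt_le_sqrt (by linarith)
  have hZ1 : 1 ≤ Z := by rw [hZ]; nlinarith
  have hZ2 : R * √Cpx ≤ Z := by rw [hZ]; nlinarith [Real.sqrt_nonneg Cpx]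
  set X := E / α * (Z * Y) with hX
  have hX0 : 0 ≤ X := by positivity
  -- Iteration 0 is online, so a transfer iteration always has data to learn from.
  have hpos : ∀ i, ¬ on i → 1 ≤ i := fun i hi =>
    Nat.one_le_iff_ne_zero.mpr fun h => hi (h ▸ h0)
  have hEα : E ≤ E / α := by rw [le_div_iff₀ hα]; nlinarith
  have hZY : 2 * COL * (R * √Cpx) * √L + 3 * b * √l ≤ Z * Y := by
    have h1 : 2 * COL * √L * (R * √Cpx) ≤ 2 * COL * √L * Z :=
      mul_le_mul_of_nonneg_left hZ2 (by positivity)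
    have h2 : 3 * b * √l * 1 ≤ 3 * b * √l * Z := mul_le_mul_of_nonneg_left hZ1 (by positivity)
    rw [hY]
    linarith
  -- First pass: at least `αi/2` of the first `i` iterations are online, so the oracle's average gap
  -- there is of order `1/√i`.
  have crude : ∀ i, i < T → ¬ on i → g i ≤ X * (1 / √(i : ℝ)) := by
    intro i hiT hi
    have hi1 := hpos i hi
    have hi0 : (0 : ℝ) < i := by exact_mod_cast hi1
    have hm0 : (0 : ℝ) < m i := lt_of_lt_of_le (by positivity) (hm i)
    have hdiv : (i : ℝ) / m i ≤ 2 / α := by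
      rw [div_le_div_iff₀ hm0 hα]
      linarith [hm i]
    have hsm : 1 / √(m i : ℝ) ≤ 2 / α * (1 / √(i : ℝ)) := by
      have h1 : √((i : ℝ) / m i) ≤ 2 / α := by
        have h2 : (1 : ℝ) ≤ 2 / α := by rw [le_div_iff₀ hα]; linarith
        refine (Real.sqrt_le_sqrt hdiv).trans ?_
        rw [Real.sqrt_le_left (by positivity)]
        nlinarith
      rw [Real.sqrt_div hi0.le] at h1
      have hs := Real.sqrt_pos.mpr hi0
      have e : 1 / √(m i : ℝ) = √(i : ℝ) / √(m i : ℝ) * (1 / √(i : ℝ)) := by field_simp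
      rw [e]
      exact mul_le_mul_of_nonneg_right h1 (by positivity)
    have h1 : (m i : ℝ)⁻¹ * ∑ j ∈ Finset.range i with on j, g j ≤
        2 * COL * (R * √Cpx) * √L * (E / α) * (1 / √(i : ℝ)) := by
      calc (m i : ℝ)⁻¹ * ∑ j ∈ Finset.range i with on j, g j
          ≤ (m i : ℝ)⁻¹ * (COL * R * E * √(Cpx * m i * L)) :=
            mul_le_mul_of_nonneg_left (hon i hi1 hiT.le) (by positivity)
        _ = COL * (R * √Cpx) * √L * E * (1 / √(m i : ℝ)) := by
            rw [Real.sqrt_mul (by positivity), Real.sqrt_mul hCpx]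
            have hs := (Real.sqrt_pos.mpr hm0).ne'
            have hsq := Real.mul_self_sqrt hm0.le
            nth_rw 1 [← hsq]
            field_simp
        _ ≤ COL * (R * √Cpx) * √L * E * (2 / α * (1 / √(i : ℝ))) :=
            mul_le_mul_of_nonneg_left hsm (by positivity)
        _ = _ := by ring
    have h2 : b * E * √(l / i) * (i / m i + 1) ≤ 3 * b * √l * (E / α) * (1 / √(i : ℝ)) := by
      have h3 : (i : ℝ) / m i + 1 ≤ 3 / α := by
        have : (1 : ℝ) ≤ 1 / α := by rw [le_div_iff₀ hα]; linarith
        have e : 3 / α = 2 / α + 1 / α := by ring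
        linarith
      rw [Real.sqrt_div hl]
      calc b * E * (√l / √(i : ℝ)) * (i / m i + 1) ≤ b * E * (√l / √(i : ℝ)) * (3 / α) :=
            mul_le_mul_of_nonneg_left h3 (by positivity)
        _ = _ := by ring
    have h4 := mul_le_mul_of_nonneg_left hZY
      (by positivity : 0 ≤ E / α * (1 / √(i : ℝ)))
    calc g i ≤ _ := hA i hiT hi
      _ ≤ E / α * (1 / √(i : ℝ)) * (2 * COL * (R * √Cpx) * √L + 3 * b * √l) := by linarith
      _ ≤ _ := h4
      _ = _ := by rw [hX]; ring
  have htr : ∀ t, t ≤ T → ∑ i ∈ Finset.range t with ¬ on i, g i ≤ 2 * X * √(t : ℝ) := by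
    intro t htT
    calc ∑ i ∈ Finset.range t with ¬ on i, g i
        ≤ ∑ i ∈ Finset.range t with ¬ on i, X * (1 / √(i : ℝ)) :=
          Finset.sum_le_sum fun i hi => by
            rw [Finset.mem_filter, Finset.mem_range] at hi
            exact crude i (hi.1.trans_le htT) hi.2
      _ ≤ ∑ i ∈ Finset.range t, X * (1 / √(i : ℝ)) :=
          Finset.sum_le_sum_of_subset_of_nonneg (Finset.filter_subset _ _)
            fun i _ _ => by positivity
      _ ≤ X * (2 * √(t : ℝ)) := by
          rw [← Finset.mul_sum]
          exact mul_le_mul_of_nonneg_left (sum_inv_sqrt_le t) hX0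
      _ = _ := by ring
  have htot : ∀ t, 1 ≤ t → t ≤ T → ∑ i ∈ Finset.range t, g i ≤ 3 * X * √(t : ℝ) := by
    intro t ht htT
    have h1 : COL * R * E * √(Cpx * m t * L) ≤ X * √(t : ℝ) := by
      have hmt' : (m t : ℝ) ≤ t := by exact_mod_cast hmt t
      have h2 : COL * (R * √Cpx) * √L ≤ Z * Y := by
        refine le_trans ?_ hZY
        have : 0 ≤ COL * (R * √Cpx) * √L := by positivity
        have : 0 ≤ 3 * b * √l := by positivity
        linarith
      rw [Real.sqrt_mul (by positivity), Real.sqrt_mul hCpx]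
      calc COL * R * E * (√Cpx * √(m t : ℝ) * √L)
          = COL * (R * √Cpx) * √L * E * √(m t : ℝ) := by ring
        _ ≤ Z * Y * (E / α) * √(t : ℝ) := by gcongr
        _ = _ := by rw [hX]; ring
    have h2 := htr t htT
    have h3 := hon t ht htT
    rw [← Finset.sum_filter_add_sum_filter_not _ on]
    linarith
  -- Second pass: the average regret is at most `3X/√i`, and with the prefactor `√(l/i)` the
  -- coefficient `X` is met only at order `1/i`.
  have refined : ∀ i, i < T → ¬ on i → g i ≤
      b * E * √l * (2 * (1 / √(i : ℝ)) + 3 * k * X * (1 / (i : ℝ))) := by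
    intro i hiT hi
    have hi1 := hpos i hi
    have hi0 : (0 : ℝ) < i := by exact_mod_cast hi1
    have hs := Real.sqrt_pos.mpr hi0
    refine (hB i hiT hi).trans ?_
    have h1 : (∑ j ∈ Finset.range i, g j) / i ≤ 3 * X * √(i : ℝ) / i :=
      div_le_div_of_nonneg_right (htot i hi1 hiT.le) hi0.le
    calc b * E * √(l / i) * (2 + k * ((∑ j ∈ Finset.range i, g j) / i))
        ≤ b * E * √(l / i) * (2 + k * (3 * X * √(i : ℝ) / i)) := by gcongr
      _ = _ := by
        rw [Real.sqrt_div hl]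
        field_simp
  calc ∑ i ∈ Finset.range t with ¬ on i, g i
      ≤ ∑ i ∈ Finset.range t with ¬ on i,
          b * E * √l * (2 * (1 / √(i : ℝ)) + 3 * k * X * (1 / (i : ℝ))) :=
        Finset.sum_le_sum fun i hi => by
          rw [Finset.mem_filter, Finset.mem_range] at hi
          exact refined i (hi.1.trans_le htT) hi.2
    _ ≤ ∑ i ∈ Finset.range t,
          b * E * √l * (2 * (1 / √(i : ℝ)) + 3 * k * X * (1 / (i : ℝ))) :=
        Finset.sum_le_sum_of_subset_of_nonneg (Finset.filter_subset _ _)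
          fun i _ _ => by positivity
    _ ≤ b * E * √l * (2 * (2 * √(t : ℝ)) + 3 * k * X * (1 + l)) := by
        rw [← Finset.mul_sum, Finset.sum_add_distrib, ← Finset.mul_sum, ← Finset.mul_sum]
        have h1 := sum_inv_sqrt_le t
        have h2 := (sum_inv_le ht).trans (add_le_add_right hlog 1)
        gcongr
    _ = _ := by rw [hX]; ring

/-- The constants of the final bounds: with `y = 2 l ≥ 1`, all logarithmic factors are powers
of `y`. -/
lemma log_factor_le {b COL c0 l : ℝ} (hb : 0 ≤ b) (hCOL : 0 ≤ COL) (hc0 : 0 ≤ c0)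
    (hl : 1 / 2 ≤ l) :
    √(l ^ c0) ≤ (2 * l) ^ ⌈c0⌉₊ ∧
    b * √l * (4 + 3 * (2 * COL * √(l ^ c0) + 3 * b * √l) * (1 + l)) ≤
      b * (4 + 6 * (2 * COL + 3 * b)) * (2 * l) ^ (⌈c0⌉₊ + 3) := by
  set y := 2 * l with hy
  have hy1 : 1 ≤ y := by linarith
  set q := ⌈c0⌉₊
  have hpow : ∀ n : ℕ, 1 ≤ y ^ n := fun n => one_le_pow₀ hy1
  have h1 : √(l ^ c0) ≤ y ^ q := by
    rw [Real.sqrt_le_left (by positivity)]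
    calc l ^ c0 ≤ y ^ c0 := Real.rpow_le_rpow (by linarith) (by linarith) hc0
      _ ≤ y ^ (q : ℝ) := Real.rpow_le_rpow_of_exponent_le hy1 (Nat.le_ceil c0)
      _ = y ^ q := Real.rpow_natCast y q
      _ ≤ (y ^ q) ^ 2 := by nlinarith [hpow q]
  have h2 : √l ≤ y := by
    rw [Real.sqrt_le_left (by positivity)]
    nlinarith
  refine ⟨h1, ?_⟩
  have hq1 : y ^ q ≤ y ^ (q + 1) := pow_le_pow_right₀ hy1 (Nat.le_succ q)
  have hy2 : y ≤ y ^ (q + 1) := le_self_pow₀ hy1 (Nat.succ_ne_zero q)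
  have h3 : 2 * COL * √(l ^ c0) + 3 * b * √l ≤ (2 * COL + 3 * b) * y ^ (q + 1) := by
    have ha := mul_le_mul_of_nonneg_left (h1.trans hq1) (by positivity : 0 ≤ 2 * COL)
    have hb' := mul_le_mul_of_nonneg_left (h2.trans hy2) (by positivity : 0 ≤ 3 * b)
    linarith
  have h4 : 1 + l ≤ 2 * y := by linarith
  have hl0 : 0 ≤ l := by linarith
  calc b * √l * (4 + 3 * (2 * COL * √(l ^ c0) + 3 * b * √l) * (1 + l))
      ≤ b * y * (4 * y ^ (q + 2) + 3 * ((2 * COL + 3 * b) * y ^ (q + 1)) * (2 * y)) := by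
        gcongr
        linarith [hpow (q + 2)]
    _ = _ := by ring

/-! ### Regret along a run -/

namespace Problem

variable {P : Problem S A} {Pi : Finset (Policy S A)} {N : ℕ} {α : ℝ}

lemma map_range_succ (x : ℕ → Step S A) (t : ℕ) :
    (List.range (t + 1)).map x = (List.range t).map x ++ [x t] := by
  rw [List.range_succ, List.map_append, List.map_singleton]

lemma regret_append (D D' : Dataset S A) : P.regret (D ++ D') = P.regret D + P.regret D' := by
  simp [regret]

lemma regret_map_range (x : ℕ → Step S A) (t : ℕ) :
    P.regret ((List.range t).map x) = ∑ i ∈ Finset.range t, P.gap (x i).policy := by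
  rw [regret, List.map_map, sum_map_range]
  rfl

lemma regret_onlineData (x : ℕ → Step S A) (t : ℕ) :
    P.regret (onlineData N α ((List.range t).map x)) =
      ∑ i ∈ Finset.range t with IsOnline N α i, P.gap (x i).policy := by
  induction t with
  | zero => simp [onlineData, regret]
  | succ t ih =>
    rw [map_range_succ, onlineData_append, Finset.range_add_one, Finset.filter_insert]
    simp only [List.length_map, List.length_range]
    split_ifs
    · rw [regret_append, ih, Finset.sum_insert (by simp), add_comm]
      simp [regret]
    · exact ih

lemma regret_transferData (x : ℕ → Step S A) (t : ℕ) :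
    P.regret (transferData N α ((List.range t).map x)) =
      ∑ i ∈ Finset.range t with ¬ IsOnline N α i, P.gap (x i).policy := by
  induction t with
  | zero => simp [transferData, regret]
  | succ t ih =>
    rw [map_range_succ, transferData_append, Finset.range_add_one, Finset.filter_insert]
    simp only [List.length_map, List.length_range]
    by_cases h : IsOnline N α t
    · rw [if_pos h, if_neg (not_not.mpr h), ih]
    · rw [if_neg h, if_pos h, regret_append, ih, Finset.sum_insert (by simp), add_comm]
      simp [regret]

lemma length_onlineData (x : ℕ → Step S A) (t : ℕ) :
    (onlineData N α ((List.range t).map x)).length = onlineCount N α t := by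
  induction t with
  | zero => simp [onlineData, onlineCount]
  | succ t ih =>
    rw [map_range_succ, onlineData_append, onlineCount_succ]
    simp only [List.length_map, List.length_range]
    split_ifs
    · rw [List.length_append, ih, List.length_singleton]
    · exact ih

/-- Translates between the clock of the whole run and the oracle's own clock. -/
lemma take_onlineData (x : ℕ → Step S A) {t T : ℕ} (h : t ≤ T) :
    (onlineData N α ((List.range T).map x)).take (onlineCount N α t) =
      onlineData N α ((List.range t).map x) := by
  rw [← length_onlineData x t, eq_comm, ← List.prefix_iff_eq_take]
  induction T, h using Nat.le_induction with
  | base => exact List.prefix_refl _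
  | succ T _ ih =>
    refine ih.trans ?_
    rw [map_range_succ, onlineData_append]
    split_ifs
    · exact List.prefix_append _ _
    · exact List.prefix_refl _

/-- The shape of the datasets that `tpo` collects. -/
lemma exists_steps_of_mem_support {alg : Dataset S A → PMF (Policy S A)}
    {tps : Dataset S A → Policy S A} (halg : ∀ D, ∀ π ∈ (alg D).support, π ∈ conv Pi)
    (htps : ∀ D, tps D ∈ conv Pi) {T : ℕ} (hT : 0 < T) (D : Dataset S A)
    (hD : D ∈ (P.runLaw (tpo N α alg tps) T).support) :
    ∃ x : ℕ → Step S A, D = (List.range T).map x ∧ (∀ i < T, (x i).policy ∈ conv Pi) ∧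
      ∀ i < T, ¬ IsOnline N α i → (x i).policy = tps ((List.range i).map x) := by
  have hlen := length_of_mem_support_runLaw D hD
  have hinv := runLaw_support_induction (P := P) (next := tpo N α alg tps)
    (motive := fun D => ∀ i (h : i < D.length), D[i].policy ∈ conv Pi ∧
      (¬ IsOnline N α i → D[i].policy = tps (D.take i)))
    (fun i h => absurd h (Nat.not_lt_zero i)) (fun D x ih hx i hi => by
      rcases Nat.lt_or_ge i D.length with h | h
      · rw [List.getElem_append_left h, List.take_append_of_le_length h.le]
        exact ih i h
      · have hi' : i = D.length := by
          rw [List.length_append, List.length_singleton] at hi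
          omega
        subst hi'
        rw [List.getElem_concat_length rfl, List.take_left']
        · rw [tpo] at hx
          split_ifs at hx with ho
          · exact ⟨halg _ _ hx, fun h => absurd ho h⟩
          · rw [PMF.mem_support_pure_iff] at hx
            exact ⟨hx ▸ htps D, fun _ => hx⟩
        · rfl) T D hD
  -- A default value that makes the sequence of samples total; it is never read below `T`.
  have x0 : Step S A := D[0]'(hlen ▸ hT)
  have hx : ∀ i, i ≤ T → (List.range i).map (fun j => D.getD j x0) = D.take i := by
    intro i hi
    refine List.ext_getElem (by simp [hlen, hi]) fun j h1 h2 => ?_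
    have hj : j < D.length := by
      rw [List.length_map, List.length_range] at h1
      omega
    simp [hj]
  refine ⟨fun j => D.getD j x0, ?_, fun i hi => ?_, fun i hi ho => ?_⟩
  · rw [hx T le_rfl, List.take_of_length_le hlen.le]
  · have := (hinv i (hlen ▸ hi)).1
    simpa [hlen ▸ hi, hlen, hi] using this
  · have := (hinv i (hlen ▸ hi)).2 ho
    rw [hx i hi.le, ← this]
    simp [hlen, hi]

/-! ### Transfer policy selection without source tasks -/

lemma exists_isMLE (hPi : P.PolicyClass Pi) (D : Dataset S A) : ∃ r, P.IsMLE Pi D r := by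
  obtain ⟨π, hπ, h⟩ := Finset.exists_min_image Pi (fun π => nll D (P.rewardOf π))
    ⟨_, hPi.realizable⟩
  refine ⟨P.rewardOf π, ⟨π, hπ, rfl⟩, ?_⟩
  rintro _ ⟨π', hπ', rfl⟩
  exact h π' hπ'

/-- Without source tasks, transfer policy selection returns exactly the self-transfer policies. -/
lemma isTPS_iff (hPi : P.PolicyClass Pi) (src : Fin 0 → S → A → ℝ) (c δ : ℝ) (T : ℕ)
    (D : Dataset S A) (π : Policy S A) :
    P.IsTPS src Pi c δ T D π ↔ ∃ r, P.IsRPO Pi D (P.eta Pi c δ T D) π r := by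
  constructor
  · rintro ⟨rM, πD, rD, i, -, h, -, rfl⟩
    rcases i with _ | w
    · exact ⟨rD, h⟩
    · exact w.elim0
  · rintro ⟨r, h⟩
    obtain ⟨rM, hM⟩ := exists_isMLE hPi D
    refine ⟨rM, π, r, none, hM, h, fun j => ?_, rfl⟩
    rcases j with _ | w
    · exact le_rfl
    · exact w.elim0

/-! ### Gap bounds with explicit constants -/

/-- From `1 + e^R ≤ 2 e^R`; this is where the factor `e^{2R}` of the transfer bounds originates. -/
lemma inv_slope_le (P : Problem S A) : 1 / P.slope ≤ 4 * Real.exp (2 * P.R) := by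
  rw [slope, one_div, inv_inv]
  have h : 1 ≤ Real.exp P.R := Real.one_le_exp P.R_pos.le
  have e : Real.exp (2 * P.R) = Real.exp P.R ^ 2 := by rw [← Real.exp_nat_mul]; norm_num
  rw [e]
  nlinarith

/-- The coefficients of the offline guarantees for `η = c s √(l / n)` and `g = s² / 2`. -/
lemma coefficient_bounds {c s E l n : ℝ} (hc : 0 < c) (hs : 0 < s) (hsE : 1 / s ≤ 4 * E)
    (hl : 0 < l) (hn : 0 < n) :
    c * s * √(l / n) / (4 * (s ^ 2 / 2)) ≤ 2 * c * E * √(l / n) ∧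
    2 * l / (c * s * √(l / n) * n) ≤ 8 / c * E * √(l / n) := by
  have hw : 0 < √(l / n) := Real.sqrt_pos.mpr (div_pos hl hn)
  have hw2 : l = √(l / n) ^ 2 * n := by
    rw [Real.sq_sqrt (div_pos hl hn).le, div_mul_cancel₀ _ hn.ne']
  generalize √(l / n) = w at hw hw2
  constructor
  · calc c * s * w / (4 * (s ^ 2 / 2)) = c / 2 * w * (1 / s) := by field_simp; norm_num
      _ ≤ c / 2 * w * (4 * E) := mul_le_mul_of_nonneg_left hsE (by positivity)
      _ = _ := by ring
  · calc 2 * l / (c * s * w * n) = 2 / c * w * (1 / s) := by rw [hw2]; field_simp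
      _ ≤ 2 / c * w * (4 * E) := mul_le_mul_of_nonneg_left hsE (by positivity)
      _ = _ := by ring

/-- The gap bounds for self-transfer policies, on the event that the likelihood bound holds. -/
lemma self_transfer_gap_le (hPi : P.PolicyClass Pi) {c δ : ℝ} (hc : 0 < c) {T n : ℕ}
    (hl : 0 < Real.log (Pi.card * T / δ)) (hn : 0 < n) {x : ℕ → Step S A}
    (hx : ∀ i ∈ Finset.range n, (x i).policy ∈ conv Pi)
    (hL : LikelihoodBound P Pi ((List.range n).map x) (fun i => (x i).policy) (P.slope ^ 2 / 2)
      (Real.log (Pi.card * T / δ)))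
    {π : Policy S A} {r : S → A → ℝ}
    (h : P.IsRPO Pi ((List.range n).map x) (P.eta Pi c δ T ((List.range n).map x)) π r) :
    (∀ I ⊆ Finset.range n, I.Nonempty →
      P.gap π ≤ (I.card : ℝ)⁻¹ * ∑ i ∈ I, P.gap (x i).policy +
        (2 * c + 8 / c) * Real.exp (2 * P.R) * √(Real.log (Pi.card * T / δ) / n) *
          (n / I.card + 1)) ∧
    P.gap π ≤ (2 * c + 8 / c) * Real.exp (2 * P.R) * √(Real.log (Pi.card * T / δ) / n) *
      (2 + kappa (Real.exp (2 * P.R / P.β)) / P.β *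
        ((∑ i ∈ Finset.range n, P.gap (x i).policy) / n)) := by
  set l := Real.log (Pi.card * T / δ) with hldef
  have hn' : (0 : ℝ) < n := by exact_mod_cast hn
  have hlen : ((List.range n).map x).length = n := by simp
  have hη : P.eta Pi c δ T ((List.range n).map x) = c * P.slope * √(l / n) := by
    rw [eta, hlen, ← hldef, slope, one_div_mul_eq_div]
  have hs := slope_pos (P := P)
  have hη0 : 0 < c * P.slope * √(l / n) := by positivity
  have hg : 0 < P.slope ^ 2 / 2 := by positivity
  rw [hη] at h
  obtain ⟨h1, h2⟩ := coefficient_bounds hc hs P.inv_slope_le hl hn'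
  set E := Real.exp (2 * P.R)
  have hE : 0 < E := Real.exp_pos _
  set w := √(l / n)
  have hw : 0 ≤ w := Real.sqrt_nonneg _
  constructor
  · intro I hI hne
    have hm : (0 : ℝ) < I.card := by exact_mod_cast hne.card_pos
    have key := h.gap_le_average hPi hη0 hg hL (by rwa [hlen]) hne (by rwa [hlen])
      fun i hi => hx i (hI hi)
    rw [hlen] at key
    refine key.trans ?_
    have e : c * P.slope * w * n / (4 * (P.slope ^ 2 / 2) * I.card) =
        c * P.slope * w / (4 * (P.slope ^ 2 / 2)) * (n / I.card) := by field_simp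
    rw [e]
    have h3 : c * P.slope * w / (4 * (P.slope ^ 2 / 2)) * (n / I.card) ≤
        2 * c * E * w * (n / I.card) := mul_le_mul_of_nonneg_right h1 (by positivity)
    have h4 : 0 ≤ 2 * c * E * w := by positivity
    have h5 : 0 ≤ 8 / c * E * w * (n / I.card) := by positivity
    linarith
  · have key := h.gap_le_coverage hPi hη0 hg hL (by rwa [hlen]) (by rwa [hlen])
    rw [hlen] at key
    refine key.trans ?_
    have hk : 0 ≤ kappa (Real.exp (2 * P.R / P.β)) / P.β *
        ((∑ i ∈ Finset.range n, P.gap (x i).policy) / n) :=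
      mul_nonneg (div_nonneg (kappa_nonneg (Real.one_lt_exp_iff.mpr
        (div_pos (mul_pos two_pos P.R_pos) P.β_pos))) P.β_pos.le)
        (div_nonneg (Finset.sum_nonneg fun i hi => gap_nonneg hPi (hx i hi)) hn'.le)
    generalize kappa (Real.exp (2 * P.R / P.β)) / P.β *
        ((∑ i ∈ Finset.range n, P.gap (x i).policy) / n) = θ at hk ⊢
    have h3 : c * P.slope * w / (4 * (P.slope ^ 2 / 2)) * (1 + θ) ≤ 2 * c * E * w * (1 + θ) :=
      mul_le_mul_of_nonneg_right h1 (by positivity)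
    have h4 : 0 ≤ 2 * c * E * w := by positivity
    have h5 : 0 ≤ 8 / c * E * w * (1 + θ) := by positivity
    linarith

end Problem

/-! ### Final constants and the regret bounds on the good event. -/

namespace Problem

variable {P : Problem S A} {Pi : Finset (Policy S A)}

/-- The gap coefficient of the offline guarantee. -/
def offlineConst (c : ℝ) : ℝ := 2 * c + 8 / c

/-- The constant of the regret bound for the transfer iterations. -/
def transferConst (c COL : ℝ) : ℝ :=
  offlineConst c * (4 + 6 * (2 * COL + 3 * offlineConst c))

/-- The constant of the final regret bounds. -/
def regretConst (c COL c0 : ℝ) : ℝ := (transferConst c COL + 2 * COL + 1) * 2 ^ (⌈c0⌉₊ + 4)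

lemma offlineConst_pos {c : ℝ} (hc : 0 < c) : 0 < offlineConst c := by
  unfold offlineConst; positivity

lemma transferConst_pos {c COL : ℝ} (hc : 0 < c) (hCOL : 0 < COL) : 0 < transferConst c COL := by
  have := offlineConst_pos hc
  unfold transferConst; positivity

lemma regretConst_pos {c COL : ℝ} (hc : 0 < c) (hCOL : 0 < COL) (c0 : ℝ) :
    0 < regretConst c COL c0 := by
  have := transferConst_pos hc hCOL
  unfold regretConst; positivity

set_option maxHeartbeats 400000 in
/-- The regret bounds on the event that the online algorithm has low regret and the likelihood
bounds hold. -/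
lemma regret_bounds (hPi : P.PolicyClass Pi) {c COL c0 : ℝ} (hc : 0 < c) (hCOL : 0 < COL)
    (hc0 : 1 ≤ c0) {N T : ℕ} {α δ Cpx L : ℝ} (hα : 0 < α) (hα1 : α < 1) (hN : 1 ≤ α * N)
    (hCpx : 0 ≤ Cpx) {tps : Dataset S A → Policy S A}
    (htps : ∀ D, ∃ r, P.IsRPO Pi D (P.eta Pi c δ T D) (tps D) r) {x : ℕ → Step S A}
    (hconv : ∀ i < T, (x i).policy ∈ conv Pi)
    (htr : ∀ i < T, ¬ IsOnline N α i → (x i).policy = tps ((List.range i).map x))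
    (hl : 1 / 2 ≤ Real.log (Pi.card * T / δ)) (hlogT : Real.log T ≤ Real.log (Pi.card * T / δ))
    (hL : ∀ i, 1 ≤ i → i ≤ T → LikelihoodBound P Pi ((List.range i).map x)
      (fun i => (x i).policy) (P.slope ^ 2 / 2) (Real.log (Pi.card * T / δ)))
    (hLle : L ≤ Real.log (Pi.card * T / δ) ^ c0)
    (hon : ∀ t, 1 ≤ t → t ≤ T → ∑ i ∈ Finset.range t with IsOnline N α i, P.gap (x i).policy ≤
      COL * P.R * Real.exp (2 * P.R) * √(Cpx * onlineCount N α t * L))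
    {t : ℕ} (hNt : N ≤ t) (htT : t ≤ T)
    (ht : regretConst c COL c0 *
      (kappa (Real.exp (2 * P.R / P.β)) / (α * P.β)) ^ 2 *
      ((1 + P.R) ^ 2 * Real.exp (4 * P.R)) * (1 + Cpx) *
      Real.log (Pi.card * T / δ) ^ (⌈c0⌉₊ + 4) ≤ t) :
    ∑ i ∈ Finset.range t with ¬ IsOnline N α i, P.gap (x i).policy ≤
      regretConst c COL c0 * Real.exp (2 * P.R) * √(t : ℝ) *
        Real.log (Pi.card * T / δ) ^ (⌈c0⌉₊ + 4) ∧
    ∑ i ∈ Finset.range t, P.gap (x i).policy ≤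
      regretConst c COL c0 * Real.exp (2 * P.R) * (1 + P.R * √(α * Cpx)) * √(t : ℝ) *
        Real.log (Pi.card * T / δ) ^ (⌈c0⌉₊ + 4) ∧
    (α * Cpx ≤ max 1 (Real.log (Pi.card * T / δ) ^ 2) →
      ∑ i ∈ Finset.range t, P.gap (x i).policy ≤
        regretConst c COL c0 * (1 + P.R) * Real.exp (2 * P.R) * √(t : ℝ) *
          Real.log (Pi.card * T / δ) ^ (⌈c0⌉₊ + 4)) := by
  set l := Real.log (Pi.card * T / δ) with hldef
  set q := ⌈c0⌉₊ with hq
  set E := Real.exp (2 * P.R) with hEdef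
  have hE : 0 < E := Real.exp_pos _
  have hR := P.R_pos
  have hβ := P.β_pos
  have hl0 : 0 < l := by linarith
  have hb := offlineConst_pos hc
  have hC1 := transferConst_pos hc hCOL
  set b := offlineConst c with hbdef
  set C1 := transferConst c COL with hC1def
  set k := kappa (Real.exp (2 * P.R / P.β)) / P.β with hk
  have hk0 : 0 ≤ k := div_nonneg (kappa_nonneg (Real.one_lt_exp_iff.mpr
    (div_pos (mul_pos two_pos hR) hβ))) hβ.le
  have hN1 : 1 ≤ N := Nat.one_le_iff_ne_zero.mpr fun h => by simp [h] at hN; linarith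
  have ht1 : 1 ≤ t := hN1.trans hNt
  have ht0 : (0 : ℝ) < t := by exact_mod_cast ht1
  have hon0 : IsOnline N α 0 := by simpa [IsOnline] using hN
  have hmpos : ∀ i, 1 ≤ i → 0 < onlineCount N α i := fun i hi => by
    have h1 := half_mul_le_onlineCount hα.le hα1.le hN i
    have hi' : (0 : ℝ) < i := by exact_mod_cast hi
    have : (0 : ℝ) < onlineCount N α i := lt_of_lt_of_le (by positivity) h1
    exact_mod_cast this
  have hgap : ∀ i, i < T → ¬ IsOnline N α i → 1 ≤ i ∧ ∃ r, P.IsRPO Pi ((List.range i).map x)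
      (P.eta Pi c δ T ((List.range i).map x)) (x i).policy r := fun i hi ho =>
    ⟨Nat.one_le_iff_ne_zero.mpr fun h => ho (h ▸ hon0), by rw [htr i hi ho]; exact htps _⟩
  have hlog : Real.log t ≤ l := (Real.log_le_log ht0 (by exact_mod_cast htT)).trans hlogT
  have htransfer := transfer_regret_le (g := fun i => P.gap (x i).policy) hE hR hα hα1.le hk0 hCpx
    hb.le hCOL.le hl0.le (half_mul_le_onlineCount hα.le hα1.le hN) onlineCount_le hon0 hon
    (fun i hi ho => by
      obtain ⟨hi1, r, hr⟩ := hgap i hi ho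
      exact (self_transfer_gap_le hPi hc hl0 hi1
        (fun j hj => hconv j ((Finset.mem_range.mp hj).trans hi)) (hL i hi1 hi.le) hr).1 _
        (Finset.filter_subset _ _) (Finset.card_pos.mp (hmpos i hi1)))
    (fun i hi ho => by
      obtain ⟨hi1, r, hr⟩ := hgap i hi ho
      exact (self_transfer_gap_le hPi hc hl0 hi1
        (fun j hj => hconv j ((Finset.mem_range.mp hj).trans hi)) (hL i hi1 hi.le) hr).2)
    ht1 htT hlog
  have hsL : √L ≤ √(l ^ c0) := Real.sqrt_le_sqrt hLle
  obtain ⟨hsq, hfac⟩ := log_factor_le hb.le hCOL.le (by linarith : 0 ≤ c0) hl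
  set y := 2 * l with hy
  have hy1 : 1 ≤ y := by linarith
  set C := regretConst c COL c0 with hC
  have hClp : C * l ^ (q + 4) = (C1 + 2 * COL + 1) * y ^ (q + 4) := by
    rw [hC, regretConst, hy, mul_pow]; ring
  -- The summand 1 in `regretConst` serves this: the factor `C l^p` can be dropped from the lower
  -- bound on `t`.
  have hClp1 : 1 ≤ C * l ^ (q + 4) := by
    rw [hClp]
    exact one_le_mul_of_one_le_of_one_le (by linarith only [hC1, hCOL]) (one_le_pow₀ hy1)
  -- The burn-in condition on `t`, in square-root form: all dependence of the transfer regret on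
  -- `𝒞(Π)`, `κ` and `α` is absorbed here.
  have hthr : k / α * (E * ((1 + P.R) * √(1 + Cpx))) ≤ √(t : ℝ) := by
    refine Real.le_sqrt_of_sq_le (le_trans ?_ ht)
    have e4 : Real.exp (4 * P.R) = E ^ 2 := by
      rw [hEdef, ← Real.exp_nat_mul]; congr 1; push_cast; ring
    have ek : kappa (Real.exp (2 * P.R / P.β)) / (α * P.β) = k / α := by
      rw [hk]; field_simp
    have hsC := Real.sq_sqrt (by linarith : 0 ≤ 1 + Cpx)
    rw [e4, ek]
    have e1 : (k / α * (E * ((1 + P.R) * √(1 + Cpx)))) ^ 2 =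
        (k / α) ^ 2 * ((1 + P.R) ^ 2 * E ^ 2) * (1 + Cpx) := by
      rw [mul_pow, mul_pow, mul_pow, hsC]; ring
    have e2 : C * (k / α) ^ 2 * ((1 + P.R) ^ 2 * E ^ 2) * (1 + Cpx) * l ^ (q + 4) =
        C * l ^ (q + 4) * ((k / α) ^ 2 * ((1 + P.R) ^ 2 * E ^ 2) * (1 + Cpx)) := by ring
    rw [e1, e2]
    exact le_mul_of_one_le_left (by positivity) hClp1
  have hst : 0 ≤ √(t : ℝ) := Real.sqrt_nonneg _
  have hTr : ∑ i ∈ Finset.range t with ¬ IsOnline N α i, P.gap (x i).policy ≤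
      C1 * y ^ (q + 3) * (E * √(t : ℝ)) := by
    refine htransfer.trans ?_
    calc b * E * √l * (4 * √(t : ℝ) + 3 * (k / α * (E * ((1 + P.R) * √(1 + Cpx)))) *
          (2 * COL * √L + 3 * b * √l) * (1 + l))
        ≤ b * E * √l * (4 * √(t : ℝ) + 3 * √(t : ℝ) *
          (2 * COL * √(l ^ c0) + 3 * b * √l) * (1 + l)) := by gcongr
      _ = b * √l * (4 + 3 * (2 * COL * √(l ^ c0) + 3 * b * √l) * (1 + l)) * (E * √(t : ℝ)) := by
        ring
      _ ≤ _ := mul_le_mul_of_nonneg_right hfac (by positivity)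
  have hOn : ∑ i ∈ Finset.range t with IsOnline N α i, P.gap (x i).policy ≤
      2 * COL * y ^ (q + 3) * (P.R * √(α * Cpx)) * (E * √(t : ℝ)) := by
    refine (hon t ht1 htT).trans ?_
    have h1 : √(Cpx * onlineCount N α t * L) ≤ 2 * (√(α * Cpx) * √(t : ℝ)) * y ^ (q + 3) := by
      have h2 : √(Cpx * onlineCount N α t) ≤ 2 * (√(α * Cpx) * √(t : ℝ)) := by
        rw [← Real.sqrt_mul (by positivity), Real.sqrt_le_left (by positivity), mul_pow,
          Real.sq_sqrt (by positivity)]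
        have := mul_le_mul_of_nonneg_left (onlineCount_le_two_mul hα.le hα1.le hN hNt) hCpx
        have h0 : 0 ≤ α * Cpx * t := by positivity
        linarith
      rw [Real.sqrt_mul (by positivity)]
      exact mul_le_mul h2 (hsL.trans (hsq.trans (pow_le_pow_right₀ hy1 (by omega))))
        (Real.sqrt_nonneg _) (by positivity)
    calc COL * P.R * E * √(Cpx * onlineCount N α t * L)
        ≤ COL * P.R * E * (2 * (√(α * Cpx) * √(t : ℝ)) * y ^ (q + 3)) := by gcongr
      _ = _ := by ring
  have hsum : ∑ i ∈ Finset.range t, P.gap (x i).policy ≤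
      (C1 + 2 * COL) * y ^ (q + 3) * (1 + P.R * √(α * Cpx)) * (E * √(t : ℝ)) := by
    rw [← Finset.sum_filter_add_sum_filter_not _ (IsOnline N α)]
    have h1 : 0 ≤ C1 * y ^ (q + 3) * (P.R * √(α * Cpx)) * (E * √(t : ℝ)) := by positivity
    have h2 : 0 ≤ 2 * COL * y ^ (q + 3) * (E * √(t : ℝ)) := by positivity
    linarith only [h1, h2, hTr, hOn]
  have hpow : y ^ (q + 3) ≤ y ^ (q + 4) := pow_le_pow_right₀ hy1 (by omega)
  have hpow' : y ^ (q + 3) * y = y ^ (q + 4) := (pow_succ _ _).symm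
  have hS : C1 + 2 * COL ≤ C1 + 2 * COL + 1 := by linarith
  have hS' : C1 ≤ C1 + 2 * COL + 1 := by linarith
  generalize C1 + 2 * COL + 1 = M at hS hS' hClp
  have hM : 0 ≤ M := hC1.le.trans hS'
  refine ⟨?_, ?_, fun hle => ?_⟩
  · calc _ ≤ C1 * y ^ (q + 3) * (E * √(t : ℝ)) := hTr
      _ ≤ M * y ^ (q + 4) * (E * √(t : ℝ)) := by
        gcongr
      _ = _ := by rw [← hClp]; ring
  · calc _ ≤ (C1 + 2 * COL) * y ^ (q + 3) * (1 + P.R * √(α * Cpx)) * (E * √(t : ℝ)) := hsum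
      _ ≤ M * y ^ (q + 4) * (1 + P.R * √(α * Cpx)) * (E * √(t : ℝ)) := by
        gcongr
      _ = _ := by rw [← hClp]; ring
  -- Trading `√(α 𝒞(Π))` for one more factor `y` is why the exponent is `q + 4` rather than `q + 3`.
  · have h1 : √(α * Cpx) ≤ y := by
      rw [Real.sqrt_le_left (by linarith)]
      refine hle.trans (max_le ?_ ?_)
      · exact one_le_pow₀ hy1
      · exact pow_le_pow_left₀ hl0.le (by linarith only [hy, hl0]) 2
    have h2 : 1 + P.R * √(α * Cpx) ≤ (1 + P.R) * y := by
      have h3 := mul_le_mul_of_nonneg_left h1 hR.le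
      linarith only [h3, hy1]
    calc _ ≤ (C1 + 2 * COL) * y ^ (q + 3) * (1 + P.R * √(α * Cpx)) * (E * √(t : ℝ)) := hsum
      _ ≤ M * y ^ (q + 3) * ((1 + P.R) * y) * (E * √(t : ℝ)) := by
        gcongr
      _ = M * (y ^ (q + 3) * y) * (1 + P.R) * (E * √(t : ℝ)) := by ring
      _ = _ := by rw [hpow', ← hClp]; ring

end Problem

end RLHF

end

/-! ### Combining the oracle event and the likelihood event. -/

theorem mainTheorem5 (c COL c0 : ℝ) (hc : 0 < c) (hCOL : 0 < COL) (hc0 : 1 ≤ c0) :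
    -- constants depending only on `c`, `COL`, `c0`
    ∃ (C : ℝ) (p : ℕ), 0 < C ∧
    ∀ (S A : Type*) [Fintype A] (P : RLHF.Problem S A) (Pi : Finset (RLHF.Policy S A)),
      P.PolicyClass Pi →
    ∀ (K N : ℕ) (α δ Cpx : ℝ), 1 ≤ K → 0 < α → α < 1 → 1 ≤ α * N → 0 < δ → δ < 1 → 0 ≤ Cpx →
    ∀ (src : Fin 0 → S → A → ℝ)
      (alg : RLHF.Dataset S A → PMF (RLHF.Policy S A))
      (tps : RLHF.Dataset S A → RLHF.Policy S A),
      P.NoRegretOnline Pi COL c0 Cpx δ (K * ⌊α * N⌋₊) alg →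
      (∀ D, P.IsTPS src Pi c δ (K * N) D (tps D)) →
    -- transfer policy selection returns exactly the self-transfer policies
    (∀ D π, P.IsTPS src Pi c δ (K * N) D π ↔
      ∃ r, P.IsRPO Pi D (P.eta Pi c δ (K * N) D) π r) ∧
    -- regret bounds, with probability at least `1 - 2δ`
    ENNReal.ofReal (1 - 2 * δ) ≤
      (P.runLaw (RLHF.tpo N α alg tps) (K * N)).toOuterMeasure
        {D | ∀ t : ℕ, N ≤ t → t ≤ K * N →
          C * (RLHF.kappa (Real.exp (2 * P.R / P.β)) / (α * P.β)) ^ 2 *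
              ((1 + P.R) ^ 2 * Real.exp (4 * P.R)) * (1 + Cpx) *
              Real.log (Pi.card * ((K * N : ℕ) : ℝ) / δ) ^ p ≤ t →
          P.regret (RLHF.transferData N α (D.take t)) ≤
            C * Real.exp (2 * P.R) * √t * Real.log (Pi.card * ((K * N : ℕ) : ℝ) / δ) ^ p ∧
          P.regret (D.take t) ≤
            C * Real.exp (2 * P.R) * (1 + P.R * √(α * Cpx)) * √t *
              Real.log (Pi.card * ((K * N : ℕ) : ℝ) / δ) ^ p ∧
          (α * Cpx ≤ max 1 (Real.log (Pi.card * ((K * N : ℕ) : ℝ) / δ) ^ 2) → P.regret (D.take t) ≤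
            C * (1 + P.R) * Real.exp (2 * P.R) * √t *
              Real.log (Pi.card * ((K * N : ℕ) : ℝ) / δ) ^ p)} := by
  refine ⟨RLHF.Problem.regretConst c COL c0, ⌈c0⌉₊ + 4,
    RLHF.Problem.regretConst_pos hc hCOL c0, ?_⟩
  intro S A _ P Pi hPi K N α δ Cpx hK hα hα1 hN hδ hδ1 hCpx src alg tps halg htps
  refine ⟨fun D π => RLHF.Problem.isTPS_iff hPi src c δ (K * N) D π, ?_⟩
  have hrpo := fun D => (RLHF.Problem.isTPS_iff hPi src c δ (K * N) D (tps D)).mp (htps D)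
  -- `αN ≥ 1` with `α < 1` excludes `N = 1`. Hence `T ≥ 2`, and `log 2 > 1/2` gives the lower bound
  -- on the logarithm.
  have hN2 : 2 ≤ N := by
    by_contra h
    have : (N : ℝ) ≤ 1 := by exact_mod_cast Nat.le_of_lt_succ (not_le.mp h)
    nlinarith
  have hT2 : 2 ≤ K * N := hN2.trans (Nat.le_mul_of_pos_left N hK)
  have hF1 : 1 ≤ ⌊α * N⌋₊ := Nat.le_floor (by exact_mod_cast hN)
  have hH1 : 1 ≤ K * ⌊α * N⌋₊ := Nat.mul_pos hK hF1
  have hHT : K * ⌊α * N⌋₊ ≤ K * N :=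
    Nat.mul_le_mul_left K (RLHF.floor_mul_le hα1.le)
  have hcard : (1 : ℝ) ≤ Pi.card := by
    exact_mod_cast Finset.card_pos.mpr ⟨_, hPi.realizable⟩
  set T := K * N with hT
  have hT2' : (2 : ℝ) ≤ T := by exact_mod_cast hT2
  have hH1' : (1 : ℝ) ≤ (K * ⌊α * N⌋₊ : ℕ) := by exact_mod_cast hH1
  have hHT' : ((K * ⌊α * N⌋₊ : ℕ) : ℝ) ≤ T := by exact_mod_cast hHT
  have hTle : (T : ℝ) ≤ Pi.card * T / δ := by
    rw [le_div_iff₀ hδ]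
    nlinarith
  have hlogT : Real.log T ≤ Real.log (Pi.card * T / δ) := Real.log_le_log (by linarith) hTle
  have hl : 1 / 2 ≤ Real.log (Pi.card * T / δ) := by
    have h1 := Real.log_le_log two_pos hT2'
    have h2 := Real.log_two_gt_d9
    linarith
  have hHle : (1 : ℝ) ≤ Pi.card * (K * ⌊α * N⌋₊ : ℕ) / δ := by
    rw [le_div_iff₀ hδ]
    nlinarith
  have hL : Real.log (Pi.card * (K * ⌊α * N⌋₊ : ℕ) / δ) ^ c0 ≤
      Real.log (Pi.card * T / δ) ^ c0 := by
    refine Real.rpow_le_rpow (Real.log_nonneg hHle) (Real.log_le_log (by linarith) ?_)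
      (by linarith)
    gcongr
  have hcount : RLHF.onlineCount N α T = K * ⌊α * N⌋₊ := RLHF.onlineCount_mul hα.le hα1.le K
  have honline := halg.regret_le
  -- The oracle's horizon is exactly the number of online iterations in the whole run, so its event
  -- pulls back to the law of the combined algorithm.
  rw [← hcount, ← RLHF.map_onlineData_runLaw P N α alg tps T, PMF.toOuterMeasure_map_apply]
    at honline
  refine RLHF.ofReal_le_toOuterMeasure_of_subset _ hδ.le honline
    (RLHF.Problem.toOuterMeasure_stepWeight_le hPi _ (by omega : 0 < T) hδ) ?_
  intro D hD hu hv t hNt htT ht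
  obtain ⟨x, rfl, hconv, htr⟩ := RLHF.Problem.exists_steps_of_mem_support halg.mem_conv
    (fun D => (hrpo D).choose_spec.1) (by omega : 0 < T) D hD
  have htake : ∀ n, n ≤ T → ((List.range T).map x).take n = (List.range n).map x :=
    fun n hn => by rw [← List.map_take, List.take_range, min_eq_left hn]
  rw [htake t htT, RLHF.Problem.regret_transferData, RLHF.Problem.regret_map_range]
  refine RLHF.Problem.regret_bounds hPi hc hCOL hc0 hα hα1 hN hCpx hrpo hconv htr hl hlogT
    (fun i hi hiT => RLHF.Problem.likelihoodBound_of_stepWeight_le hi fun r hr => ?_) hL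
    (fun i hi hiT => ?_) hNt htT ht
  · rw [← htake i hiT]
    exact hv i hiT hi r hr
  · have hi0 : 1 ≤ RLHF.onlineCount N α i := by
      have h1 := RLHF.half_mul_le_onlineCount hα.le hα1.le hN i
      have hi' : (0 : ℝ) < i := by exact_mod_cast hi
      have h2 : (0 : ℝ) < RLHF.onlineCount N α i := lt_of_lt_of_le (by positivity) h1
      exact_mod_cast h2
    -- The anytime guarantee is read at the oracle's local time, the number of online iterations up
    -- to `i`.
    have h := hu (RLHF.onlineCount N α i) hi0 (RLHF.onlineCount_mono hiT)
    rwa [RLHF.Problem.take_onlineData x hiT, RLHF.Problem.regret_onlineData, hcount] at h
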